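/- All topological groups are Hausdorff; TDLC means totally disconnected locally compact. A topological group is compactly generated if it is generated, as an abstract group, by a compact subset. A Cayley–Abels graph of a TDLC group $G$ is a non-empty connected locally finite graph on which $G$ acts by graph automorphisms, transitively on vertices and with compact open vertex stabilizers. A TDLC group $G$ is hyperbolic if it is compactly generated and some Cayley–Abels graph of $G$, with all edges of length one, is Gromov hyperbolic. (a) Let $A$ and $B$ be compactly generated TDLC groups, let $C$ be a compact topological group, and let $i_A\colon C\to A$ and $i_B\colon C\to B$ be homomorphisms that are open topological embeddings. Let $G=A*_C B$ be the amalgamated free product, that is, the quotient of the free product of $A$ and $B$ by the relations $i_A(c)=i_B(c)$ for $c\in C$, with the unique group topology for which the canonical maps $A\to G$ and $B\to G$ are open topological embeddings. Then $G$ is a hyperbolic TDLC group if and only if $A$ and $B$ are hyperbolic. (b) Let $A$ be a compactly generated TDLC group, let $C$ be a compact open subgroup of $A$, and let $\alpha\colon C\to D$ be a topological isomorphism onto an open subgroup $D$ of $A$. Let $G=A*_C=\langle A,t\mid t^{-1}ct=\alpha(c)\text{ for all }c\in C\rangle$ be the HNN extension, with the unique group topology for which the canonical map $A\to G$ is an open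 topological embedding. Then $G$ is a hyperbolic TDLC group if and only if $A$ is hyperbolic. -/

import Mathlib

open Topology

universe u v w

/-- A totally disconnected locally compact (Hausdorff) topological group. -/
structure IsTDLCGroup (G : Type*) [Group G] [TopologicalSpace G] : Prop where
  isTopologicalGroup : IsTopologicalGroup G
  t2Space : T2Space G
  locallyCompactSpace : LocallyCompactSpace G
  totallyDisconnectedSpace : TotallyDisconnectedSpace G

/-- A topological group is compactly generated if some compact subset generates it
algebraically. -/
def IsCompactlyGeneratedGroup (G : Type*) [Group G] [TopologicalSpace G] : Prop :=
  ∃ K : Set G, IsCompact K ∧ Subgroup.closure K = ⊤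

/-- A Cayley–Abels graph of `G`: a locally finite connected graph on which `G` acts by graph
automorphisms, transitively on the vertices and with compact open vertex stabilizers. -/
structure IsCayleyAbelsGraph (G : Type*) [Group G] [TopologicalSpace G] {V : Type*}
    [MulAction G V] (X : SimpleGraph V) : Prop where
  connected : X.Connected
  locallyFinite : ∀ x : V, (X.neighborSet x).Finite
  smul_adj : ∀ (g : G) (x y : V), X.Adj x y → X.Adj (g • x) (g • y)
  transitive : ∀ x y : V, ∃ g : G, g • x = y
  isCompact_stabilizer : ∀ x : V, IsCompact (MulAction.stabilizer G x : Set G)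
  isOpen_stabilizer : ∀ x : V, IsOpen (MulAction.stabilizer G x : Set G)

/-- A connected graph (edges of length one) is Gromov hyperbolic if for some `δ` all its geodesic
triangles are `δ`-slim: every side lies in the `δ`-neighbourhood of the union of the other two.
A geodesic is a walk whose length is the distance between its endpoints. -/
def IsGromovHyperbolicGraph {V : Type*} (X : SimpleGraph V) : Prop :=
  X.Connected ∧ ∃ δ : ℕ, ∀ (x y z : V) (p : X.Walk x y) (q : X.Walk y z) (r : X.Walk x z),
    p.length = X.dist x y → q.length = X.dist y z → r.length = X.dist x z →
      ∀ a ∈ p.support, ∃ b : V, (b ∈ q.support ∨ b ∈ r.support) ∧ X.dist a b ≤ δ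

/-- A hyperbolic TDLC group: a compactly generated TDLC group some Cayley–Abels graph of which is
Gromov hyperbolic. (The vertex set of a Cayley–Abels graph is in bijection with a set of cosets
of `G`, so that the universe of `G` is large enough.) -/
structure IsHyperbolicTDLCGroup (G : Type u) [Group G] [TopologicalSpace G] : Prop where
  isTDLCGroup : IsTDLCGroup G
  isCompactlyGeneratedGroup : IsCompactlyGeneratedGroup G
  exists_hyperbolic_cayleyAbelsGraph : ∃ (V : Type u) (_ : MulAction G V) (X : SimpleGraph V),
    IsCayleyAbelsGraph G X ∧ IsGromovHyperbolicGraph X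

/-- For a homomorphism `f : K →* G` from a topological group to a group, the finest topology on
`G` for which all the maps `k ↦ g * f k` are continuous. If `f` is injective, this makes `G` the
disjoint union of the left cosets `g * f(K)`, each an open copy of `K`. -/
@[reducible] def leftCosetTopology {K : Type*} {G : Type*} [Group K] [TopologicalSpace K]
    [Group G] (f : K →* G) : TopologicalSpace G where
  IsOpen U := ∀ g : G, IsOpen ((fun k : K => g * f k) ⁻¹' U)
  isOpen_univ _ := isOpen_univ
  isOpen_inter _ _ hU hV g := (hU g).inter (hV g)
  isOpen_sUnion S hS g := by
    rw [Set.preimage_sUnion]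
    exact isOpen_biUnion fun U hU => hS U hU g

section LeftCosetTopology

open Filter

variable {K : Type*} {G : Type*} [Group K] [TopologicalSpace K] [IsTopologicalGroup K] [Group G]

theorem mem_nhds_leftCosetTopology (f : K →* G) (g : G) (S : Set G) :
    S ∈ @nhds G (leftCosetTopology f) g ↔ (fun k : K => g * f k) ⁻¹' S ∈ 𝓝 (1 : K) := by
  let _ := leftCosetTopology f
  constructor
  · intro h
    obtain ⟨U, hUS, hU, hg⟩ := mem_nhds_iff.1 h
    exact mem_of_superset ((hU g).mem_nhds (by simpa using hg)) (Set.preimage_mono hUS)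
  · intro h
    obtain ⟨W, hWS, hW, h1⟩ := mem_nhds_iff.1 h
    refine mem_nhds_iff.2 ⟨(fun k : K => g * f k) '' W, by rintro _ ⟨w, hw, rfl⟩; exact hWS hw,
      fun x => ?_, ⟨1, h1, by simp⟩⟩
    refine isOpen_iff_mem_nhds.2 ?_
    rintro k₀ ⟨w₀, hw₀, hk₀⟩
    have hc : Continuous fun k : K => w₀ * (k₀⁻¹ * k) := by fun_prop
    refine mem_of_superset ((hW.preimage hc).mem_nhds (by simpa using hw₀)) fun k hk => ?_
    refine ⟨_, hk, ?_⟩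
    simp only at hk₀ ⊢
    rw [map_mul, ← mul_assoc, hk₀, mul_assoc, ← map_mul, mul_inv_cancel_left]

/-- If conjugation by every element of `G` is continuous near the identity of `K`, then
`leftCosetTopology f` is a group topology. -/
theorem isTopologicalGroup_leftCosetTopology (f : K →* G)
    (h : ∀ g : G, ∀ U ∈ 𝓝 (1 : K), ∀ᶠ k in 𝓝 (1 : K), ∃ u ∈ U, g * f k * g⁻¹ = f u) :
    @IsTopologicalGroup G (leftCosetTopology f) _ := by
  let _ := leftCosetTopology f
  have h1 : 𝓝 (1 : G) = map f (𝓝 1) := by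
    ext S
    rw [mem_nhds_leftCosetTopology, mem_map]
    simp
  refine IsTopologicalGroup.of_nhds_one ?_ ?_ ?_ ?_
  · rw [h1, prod_map_map_eq, tendsto_map'_iff]
    have : Tendsto (fun p : K × K => f (p.1 * p.2)) (𝓝 1 ×ˢ 𝓝 1) (map f (𝓝 1)) :=
      tendsto_map.comp (by simpa [nhds_prod_eq] using (tendsto_mul (a := (1 : K)) (b := 1)))
    simpa [Function.comp_def, Function.uncurry] using this
  · rw [h1, tendsto_map'_iff]
    have : Tendsto (fun k : K => f k⁻¹) (𝓝 1) (map f (𝓝 1)) :=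
      tendsto_map.comp (by simpa using (tendsto_inv (1 : K)))
    simpa [Function.comp_def] using this
  · intro g
    ext S
    rw [mem_nhds_leftCosetTopology, mem_map, h1, mem_map]
    rfl
  · intro g S hS
    rw [h1, mem_map] at hS
    rw [h1, mem_map, mem_map]
    filter_upwards [h g _ hS] with k hk
    obtain ⟨u, hu, hk⟩ := hk
    change g * f k * g⁻¹ ∈ S
    rw [hk]
    exact hu

/-- The elements of `G` by which conjugation is continuous near the identity of `K` are closed
under products. -/
theorem conj_eventually_mul (f : K →* G) {g g' : G}
    (h : ∀ U ∈ 𝓝 (1 : K), ∀ᶠ k in 𝓝 (1 : K), ∃ u ∈ U, g * f k * g⁻¹ = f u)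
    (h' : ∀ U ∈ 𝓝 (1 : K), ∀ᶠ k in 𝓝 (1 : K), ∃ u ∈ U, g' * f k * g'⁻¹ = f u) :
    ∀ U ∈ 𝓝 (1 : K), ∀ᶠ k in 𝓝 (1 : K), ∃ u ∈ U, g * g' * f k * (g * g')⁻¹ = f u := by
  intro U hU
  filter_upwards [h' _ (h U hU)] with k hk
  obtain ⟨u, ⟨w, hw, h2⟩, h1⟩ := hk
  exact ⟨w, hw, by rw [← h2, ← h1]; group⟩

/-- If `f` factors as an open embedding `i : K →* A` followed by `j : A →* G`, then conjugation by
elements of the image of `j` is continuous near the identity of `K`. -/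
theorem conj_eventually_of_isOpenEmbedding {A : Type*} [Group A] [TopologicalSpace A]
    [IsTopologicalGroup A] {i : K →* A}
    (hi : IsOpenEmbedding i) (j : A →* G) (a : A) (U : Set K) (hU : U ∈ 𝓝 (1 : K)) :
    ∀ᶠ k in 𝓝 (1 : K), ∃ u ∈ U, j a * (j.comp i) k * (j a)⁻¹ = (j.comp i) u := by
  have hc : Continuous fun k : K => a * i k * a⁻¹ := by
    have := hi.continuous
    fun_prop
  have h1 : i '' U ∈ 𝓝 (a * i 1 * a⁻¹) := by
    have := hi.isOpenMap.image_mem_nhds hU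
    simpa using this
  filter_upwards [hc.continuousAt h1] with k hk
  obtain ⟨u, hu, h⟩ := hk
  refine ⟨u, hu, ?_⟩
  simp only [MonoidHom.comp_apply, ← map_inv, ← map_mul]
  rw [h]

/-- A group topology on `G` for which `f` is an open embedding is `leftCosetTopology f`. -/
theorem eq_leftCosetTopology (f : K →* G) (τ : TopologicalSpace G)
    (hτ : @IsTopologicalGroup G τ _) (hf : @IsOpenEmbedding K G _ τ f) :
    τ = leftCosetTopology f := by
  ext U
  constructor
  · intro hU g
    exact hU.preimage ((continuous_const_mul g).comp hf.continuous)
  · intro hU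
    refine isOpen_iff_mem_nhds.2 fun g hg => ?_
    have h1 : IsOpen (f '' ((fun k : K => g * f k) ⁻¹' U)) := hf.isOpenMap _ (hU g)
    have h2 := (isOpenMap_mul_left g) _ h1
    refine mem_of_superset (h2.mem_nhds ⟨1, ⟨1, by simpa using hg, by simp⟩, by simp⟩) ?_
    rintro _ ⟨_, ⟨k, hk, rfl⟩, rfl⟩
    exact hk

/-- If `i : K →* H` is an open embedding and `j : H →* G` is injective, then `j` is an open
embedding for the topology `leftCosetTopology (j.comp i)`. -/
theorem isOpenEmbedding_leftCosetTopology {H : Type*} [Group H] [TopologicalSpace H]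
    [IsTopologicalGroup H] (i : K →* H) (j : H →* G) (hi : IsOpenEmbedding i)
    (hj : Function.Injective j) :
    @IsOpenEmbedding H G _ (leftCosetTopology (j.comp i)) j := by
  let _ := leftCosetTopology (j.comp i)
  have key : ∀ (a : H) (S : Set G), S ∈ 𝓝 (j a) ↔ j ⁻¹' S ∈ 𝓝 a := by
    intro a S
    rw [mem_nhds_leftCosetTopology, ← map_mul_left_nhds_one a, mem_map, ← map_one i,
      ← hi.map_nhds_eq, mem_map]
    simp [Set.preimage_preimage]
  refine IsOpenEmbedding.of_continuous_injective_isOpenMap ?_ hj ?_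
  · exact continuous_iff_continuousAt.2 fun a S hS => (key a S).1 hS
  · refine IsOpenMap.of_nhds_le fun a S hS => (key a S).2 hS

end LeftCosetTopology

/-- The amalgamated free product `A *_C B` along `iA : C →* A` and `iB : C →* B`: the quotient of
the free product of `A` and `B` by the relations `iA c = iB c` for `c` in `C`. -/
def AmalgamatedProduct {A : Type u} {B : Type v} {C : Type w} [Group A] [Group B] [Group C]
    (iA : C →* A) (iB : C →* B) : Type (max u v) :=
  Monoid.Coprod A B ⧸ Subgroup.normalClosure
    {x : Monoid.Coprod A B | ∃ c : C,
      x = Monoid.Coprod.inl (iA c) * (Monoid.Coprod.inr (iB c))⁻¹}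

namespace AmalgamatedProduct

variable {A : Type u} {B : Type v} {C : Type w} [Group A] [Group B] [Group C]

instance (iA : C →* A) (iB : C →* B) : Group (AmalgamatedProduct iA iB) :=
  inferInstanceAs (Group (Monoid.Coprod A B ⧸ Subgroup.normalClosure
    {x : Monoid.Coprod A B | ∃ c : C,
      x = Monoid.Coprod.inl (iA c) * (Monoid.Coprod.inr (iB c))⁻¹}))

/-- The canonical homomorphism `A → A *_C B`. -/
def inl (iA : C →* A) (iB : C →* B) : A →* AmalgamatedProduct iA iB :=
  (QuotientGroup.mk' (Subgroup.normalClosure {x : Monoid.Coprod A B | ∃ c : C,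
    x = Monoid.Coprod.inl (iA c) * (Monoid.Coprod.inr (iB c))⁻¹})).comp Monoid.Coprod.inl

/-- The canonical homomorphism `B → A *_C B`. -/
def inr (iA : C →* A) (iB : C →* B) : B →* AmalgamatedProduct iA iB :=
  (QuotientGroup.mk' (Subgroup.normalClosure {x : Monoid.Coprod A B | ∃ c : C,
    x = Monoid.Coprod.inl (iA c) * (Monoid.Coprod.inr (iB c))⁻¹})).comp Monoid.Coprod.inr

/-- The topology of `A *_C B`, for `iA` and `iB` open topological embeddings: the left cosets of
`C` are open and carry the topology of `C`. It is the unique group topology for which `A` and `B`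
are open and topologically embedded. -/
instance [TopologicalSpace C] (iA : C →* A) (iB : C →* B) :
    TopologicalSpace (AmalgamatedProduct iA iB) :=
  leftCosetTopology ((inl iA iB).comp iA)

theorem inl_eq_inr (iA : C →* A) (iB : C →* B) (c : C) :
    inl iA iB (iA c) = inr iA iB (iB c) := by
  refine (div_eq_one.1 ?_)
  rw [div_eq_mul_inv]
  exact (QuotientGroup.eq_one_iff _).2 (Subgroup.subset_normalClosure ⟨c, rfl⟩)

/-- The universal property of the amalgamated free product. -/
def lift {M : Type*} [Group M] (iA : C →* A) (iB : C →* B) (f : A →* M) (g : B →* M)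
    (h : ∀ c, f (iA c) = g (iB c)) : AmalgamatedProduct iA iB →* M :=
  QuotientGroup.lift _ (Monoid.Coprod.lift f g) (by
    refine Subgroup.normalClosure_le_normal ?_
    rintro _ ⟨c, rfl⟩
    simp [MonoidHom.mem_ker, h])

theorem lift_inl {M : Type*} [Group M] (iA : C →* A) (iB : C →* B) (f : A →* M) (g : B →* M)
    (h : ∀ c, f (iA c) = g (iB c)) (a : A) : lift iA iB f g h (inl iA iB a) = f a := by
  change Monoid.Coprod.lift f g (Monoid.Coprod.inl a) = f a
  simp

theorem lift_inr {M : Type*} [Group M] (iA : C →* A) (iB : C →* B) (f : A →* M) (g : B →* M)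
    (h : ∀ c, f (iA c) = g (iB c)) (b : B) : lift iA iB f g h (inr iA iB b) = g b := by
  change Monoid.Coprod.lift f g (Monoid.Coprod.inr b) = g b
  simp

theorem induction_on {iA : C →* A} {iB : C →* B} {p : AmalgamatedProduct iA iB → Prop}
    (x : AmalgamatedProduct iA iB) (hl : ∀ a, p (inl iA iB a)) (hr : ∀ b, p (inr iA iB b))
    (hm : ∀ x y, p x → p y → p (x * y)) : p x := by
  obtain ⟨y, rfl⟩ := QuotientGroup.mk'_surjective _ x
  induction y using Monoid.Coprod.induction_on with
  | inl a => exact hl a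
  | inr b => exact hr b
  | mul x y hx hy => exact hm _ _ hx hy

/-- The two factors as a family of groups. -/
def Factor (A : Type u) (B : Type v) (b : Bool) : Type (max u v) :=
  bif b then ULift.{v} A else ULift.{u} B

instance Factor.instGroup (b : Bool) : Group (Factor A B b) :=
  match b with
  | true => inferInstanceAs (Group (ULift.{v} A))
  | false => inferInstanceAs (Group (ULift.{u} B))

/-- The identification of `A` with the first factor. -/
def Factor.inl (A : Type u) (B : Type v) [Group A] [Group B] : A →* Factor A B true where
  toFun := ULift.up
  map_one' := rfl
  map_mul' _ _ := rfl

/-- The identification of `B` with the second factor. -/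
def Factor.inr (A : Type u) (B : Type v) [Group A] [Group B] : B →* Factor A B false where
  toFun := ULift.up
  map_one' := rfl
  map_mul' _ _ := rfl

/-- The maps of `C` to the two factors as a family. -/
def factorMap (iA : C →* A) (iB : C →* B) (b : Bool) : C →* Factor A B b :=
  match b with
  | true => (Factor.inl A B).comp iA
  | false => (Factor.inr A B).comp iB

/-- The comparison map from the amalgamated free product to Mathlib's pushout of groups. -/
def toPushout (iA : C →* A) (iB : C →* B) :
    AmalgamatedProduct iA iB →* Monoid.PushoutI (factorMap iA iB) :=
  lift iA iB
    ((Monoid.PushoutI.of (φ := factorMap iA iB) true).comp (Factor.inl A B))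
    ((Monoid.PushoutI.of (φ := factorMap iA iB) false).comp (Factor.inr A B))
    fun c => (Monoid.PushoutI.of_apply_eq_base (factorMap iA iB) true c).trans
      (Monoid.PushoutI.of_apply_eq_base (factorMap iA iB) false c).symm

theorem factorMap_injective {iA : C →* A} {iB : C →* B} (hA : Function.Injective iA)
    (hB : Function.Injective iB) (b : Bool) : Function.Injective (factorMap iA iB b) :=
  match b with
  | true => ULift.up_injective.comp hA
  | false => ULift.up_injective.comp hB

theorem inl_injective {iA : C →* A} {iB : C →* B} (hA : Function.Injective iA)
    (hB : Function.Injective iB) : Function.Injective (inl iA iB) := by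
  intro a a' h
  have h' := congrArg (toPushout iA iB) h
  simp only [toPushout, lift_inl] at h'
  exact ULift.up_injective
    (Monoid.PushoutI.of_injective (factorMap_injective hA hB) true h')

theorem inr_injective {iA : C →* A} {iB : C →* B} (hA : Function.Injective iA)
    (hB : Function.Injective iB) : Function.Injective (inr iA iB) := by
  intro a a' h
  have h' := congrArg (toPushout iA iB) h
  simp only [toPushout, lift_inr] at h'
  exact ULift.up_injective
    (Monoid.PushoutI.of_injective (factorMap_injective hA hB) false h')

theorem comp_eq (iA : C →* A) (iB : C →* B) :
    (inl iA iB).comp iA = (inr iA iB).comp iB :=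
  MonoidHom.ext (inl_eq_inr iA iB)

variable [TopologicalSpace A] [TopologicalSpace B] [TopologicalSpace C]
  [IsTopologicalGroup A] [IsTopologicalGroup B] [IsTopologicalGroup C]

theorem isOpenEmbedding_inl {iA : C →* A} {iB : C →* B} (hA : IsOpenEmbedding iA)
    (hB : IsOpenEmbedding iB) : IsOpenEmbedding (inl iA iB) :=
  isOpenEmbedding_leftCosetTopology iA (inl iA iB) hA (inl_injective hA.injective hB.injective)

theorem isOpenEmbedding_inr {iA : C →* A} {iB : C →* B} (hA : IsOpenEmbedding iA)
    (hB : IsOpenEmbedding iB) : IsOpenEmbedding (inr iA iB) := by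
  have h := isOpenEmbedding_leftCosetTopology iB (inr iA iB) hB
    (inr_injective hA.injective hB.injective)
  rw [← comp_eq] at h
  exact h

theorem isTopologicalGroup {iA : C →* A} {iB : C →* B} (hA : IsOpenEmbedding iA)
    (hB : IsOpenEmbedding iB) : IsTopologicalGroup (AmalgamatedProduct iA iB) := by
  refine isTopologicalGroup_leftCosetTopology _ fun g => ?_
  induction g using induction_on with
  | hl a => exact conj_eventually_of_isOpenEmbedding hA _ a
  | hr b => rw [comp_eq]; exact conj_eventually_of_isOpenEmbedding hB _ b
  | hm x y hx hy => exact conj_eventually_mul _ hx hy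

theorem topology_unique {iA : C →* A} {iB : C →* B} (hA : IsOpenEmbedding iA)
    (τ : TopologicalSpace (AmalgamatedProduct iA iB))
    (hτ : @IsTopologicalGroup _ τ _) (h : @IsOpenEmbedding _ _ _ τ (inl iA iB)) :
    τ = leftCosetTopology ((inl iA iB).comp iA) :=
  eq_leftCosetTopology ((inl iA iB).comp iA) τ hτ (h.comp hA)

end AmalgamatedProduct

/-- The HNN extension `A *_C` of `A` along an isomorphism `α : C ≃* D` of subgroups of `A`: the
group generated by `A` and a letter `t` with the relations `t⁻¹ * c * t = α c` for `c` in `C`.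
(The relations of Mathlib's `HNNExtension A D C α.symm` are `t * d = α.symm d * t` for `d` in
`D`, which are the same.) -/
def TopHNNExtension {A : Type u} [Group A] {C D : Subgroup A} (α : C ≃* D) : Type u :=
  HNNExtension A D C α.symm

namespace TopHNNExtension

variable {A : Type u} [Group A] {C D : Subgroup A}

instance (α : C ≃* D) : Group (TopHNNExtension α) :=
  inferInstanceAs (Group (HNNExtension A D C α.symm))

/-- The canonical homomorphism `A → A *_C`. -/
def of (α : C ≃* D) : A →* TopHNNExtension α :=
  (HNNExtension.of : A →* HNNExtension A D C α.symm)

/-- The stable letter of `A *_C`. -/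
def t (α : C ≃* D) : TopHNNExtension α :=
  (HNNExtension.t : HNNExtension A D C α.symm)

/-- The topology of `A *_C`, for `α` a topological isomorphism of open subgroups of `A`: the left
cosets of `A` are open and carry the topology of `A`. It is the unique group topology for which
`A` is open and topologically embedded. -/
instance [TopologicalSpace A] (α : C ≃* D) : TopologicalSpace (TopHNNExtension α) :=
  leftCosetTopology (of α)

theorem of_injective (α : C ≃* D) : Function.Injective (of α) :=
  HNNExtension.of_injective (φ := α.symm)

theorem t_inv_mul_of_mul_t (α : C ≃* D) (c : C) :
    (t α)⁻¹ * of α (c : A) * t α = of α (α c : A) :=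
  (HNNExtension.equiv_symm_eq_conj (φ := α.symm) c).symm

theorem t_mul_of_mul_t_inv (α : C ≃* D) (d : D) :
    t α * of α (d : A) * (t α)⁻¹ = of α (α.symm d : A) :=
  (HNNExtension.equiv_eq_conj (φ := α.symm) d).symm

theorem induction_on {α : C ≃* D} {p : TopHNNExtension α → Prop} (x : TopHNNExtension α)
    (hof : ∀ a, p (of α a)) (ht : p (t α)) (hmul : ∀ x y, p x → p y → p (x * y))
    (hinv : ∀ x, p x → p x⁻¹) : p x :=
  HNNExtension.induction_on (φ := α.symm) (motive := p) x hof ht hmul hinv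

variable [TopologicalSpace A] [IsTopologicalGroup A]

theorem isOpenEmbedding_of (α : C ≃* D) : IsOpenEmbedding (of α) :=
  isOpenEmbedding_leftCosetTopology (MonoidHom.id A) (of α) .id (of_injective α)

theorem conj_eventually_of_mulEquiv {G : Type*} [Group G] {C D : Subgroup A}
    (hC : IsOpen (C : Set A)) (α : C → D) (hα : Continuous α) (h1 : α 1 = 1) (f : A →* G) (g : G)
    (h : ∀ c : C, g * f c * g⁻¹ = f (α c)) (U : Set A) (hU : U ∈ 𝓝 (1 : A)) :
    ∀ᶠ k in 𝓝 (1 : A), ∃ u ∈ U, g * f k * g⁻¹ = f u := by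
  have hc : Continuous fun c : C => (α c : A) := continuous_subtype_val.comp hα
  have h2 : (fun c : C => (α c : A)) ⁻¹' U ∈ 𝓝 (1 : C) :=
    hc.continuousAt (by simpa [h1] using hU)
  have h3 := hC.isOpenMap_subtype_val.image_mem_nhds h2
  filter_upwards [h3] with k hk
  obtain ⟨c, hcU, rfl⟩ := hk
  exact ⟨_, hcU, h c⟩

theorem isTopologicalGroup (α : C ≃ₜ* D) (hC : IsOpen (C : Set A)) (hD : IsOpen (D : Set A)) :
    IsTopologicalGroup (TopHNNExtension α.toMulEquiv) := by
  have hof : ∀ a : A, ∀ U ∈ 𝓝 (1 : A), ∀ᶠ k in 𝓝 (1 : A), ∃ u ∈ U,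
      of α.toMulEquiv a * of α.toMulEquiv k * (of α.toMulEquiv a)⁻¹ = of α.toMulEquiv u :=
    fun a U hU => conj_eventually_of_isOpenEmbedding (i := MonoidHom.id A) .id
      (of α.toMulEquiv) a U hU
  refine isTopologicalGroup_leftCosetTopology (of α.toMulEquiv) fun g => ?_
  refine And.left (b := ∀ U ∈ 𝓝 (1 : A), ∀ᶠ k in 𝓝 (1 : A), ∃ u ∈ U,
      g⁻¹ * of α.toMulEquiv k * (g⁻¹)⁻¹ = of α.toMulEquiv u) ?_
  induction g using induction_on with
  | hof a =>
    refine ⟨hof a, ?_⟩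
    have h := hof a⁻¹
    rw [map_inv] at h
    exact h
  | ht =>
    constructor
    · exact conj_eventually_of_mulEquiv hD α.symm α.symm.continuous (map_one _) _ _ fun d =>
        t_mul_of_mul_t_inv α.toMulEquiv d
    · refine conj_eventually_of_mulEquiv hC α α.continuous (map_one _) _ _ fun c => ?_
      rw [inv_inv]
      exact t_inv_mul_of_mul_t α.toMulEquiv c
  | hmul x y hx hy =>
    refine ⟨conj_eventually_mul _ hx.1 hy.1, ?_⟩
    have h := conj_eventually_mul _ hy.2 hx.2
    rw [← mul_inv_rev] at h
    exact h
  | hinv x hx => exact ⟨hx.2, by rw [inv_inv]; exact hx.1⟩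

theorem topology_unique (α : C ≃* D) (τ : TopologicalSpace (TopHNNExtension α))
    (hτ : @IsTopologicalGroup _ τ _) (h : @IsOpenEmbedding _ _ _ τ (of α)) :
    τ = leftCosetTopology (of α) :=
  eq_leftCosetTopology (of α) τ hτ h

end TopHNNExtension

/-! Let `G` be the amalgam or the HNN extension, with its Bass–Serre tree, whose edges are the
cosets `G ⧸ C`. The coset graph on `G ⧸ C`, for a compact generating set inside the vertex groups
(and the stable letter), is a Cayley–Abels graph of `G`. Adjacent cosets are tree edges with a
common end, so every edge of the graph lies in the star of a tree vertex. These stars are the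
blocks: translates of `A/C` and `B/C`, or, for HNN extensions, of the set of cosets `aC` and
`at⁻¹C`.

The graph is a tree of blocks glued along cut vertices: it retracts onto each block so that every
edge outside is collapsed (`IsBlockRetraction`). Geodesics between vertices of a block therefore
stay in it, and a block inherits hyperbolicity (`isGromovHyperbolicGraph_induce`). Conversely, a
geodesic triangle projects to a geodesic triangle in each block that one of its sides crosses; as
there are finitely many blocks up to translation, slim triangles in the blocks give slim triangles
in the graph (`isGromovHyperbolicGraph_of_blocks`).

A block is within bounded distance of an orbit of the open vertex group, so it is hyperbolic exactly
when that group is (`isHyperbolicTDLCGroup_iff_block`). This is a Milnor–Schwarz argument, and the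
invariance of hyperbolicity that it needs (`IsGromovHyperbolicGraph.of_coarse_retract`) comes from
guessing geodesics: a family of coarse paths with thin triangles forces hyperbolicity.

The retractions are found without normal forms. The universal property makes `G` act on `G × (G ⧸ C
→₀ ℤ)` by translations twisted by a shear, and the second coordinate records the first tree edge of
a reduced decomposition. -/

/-! ### Subwalks of geodesics -/

namespace SimpleGraph

variable {V : Type*} {X : SimpleGraph V}

theorem Walk.exists_subwalk {x y : V} (p : X.Walk x y) {i j : ℕ} (hij : i ≤ j)
    (hj : j ≤ p.length) :
    ∃ q : X.Walk (p.getVert i) (p.getVert j), q.length = j - i ∧ q.IsSubwalk p ∧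
      ∀ s, s ∈ q.support ↔ ∃ k, i ≤ k ∧ k ≤ j ∧ p.getVert k = s := by
  have he : (p.drop i).getVert (j - i) = p.getVert j := by
    rw [Walk.drop_getVert]; congr 1; omega
  have hl : (((p.drop i).take (j - i)).copy rfl he).length = j - i := by
    simp; omega
  refine ⟨((p.drop i).take (j - i)).copy rfl he, hl, ?_, fun s => ?_⟩
  · have h1 : ((p.drop i).take (j - i)).IsSubwalk (p.drop i) := by
      exact Walk.isSubwalk_take _ _
    have h2 : (p.drop i).IsSubwalk p := Walk.isSubwalk_drop _ _
    have h3 : ∀ {b c : V} (w : X.Walk (p.getVert i) b) (h : b = c), w.IsSubwalk p →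
        (w.copy rfl h).IsSubwalk p := by
      rintro _ _ w rfl h
      exact h
    exact h3 _ he (h1.trans h2)
  · rw [Walk.mem_support_iff_exists_getVert, hl]
    constructor
    · rintro ⟨n, rfl, hn⟩
      refine ⟨i + n, by omega, by omega, ?_⟩
      simp [Walk.take_getVert, Walk.drop_getVert, hn]
    · rintro ⟨k, h1, h2, rfl⟩
      refine ⟨k - i, ?_, by omega⟩
      simp only [Walk.getVert_copy, Walk.take_getVert, Walk.drop_getVert]
      congr 1; omega

/-- The subwalks of geodesics are geodesics. -/
theorem Walk.exists_geodesic_subwalk {x y : V} {p : X.Walk x y} (hp : p.length = X.dist x y)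
    {i j : ℕ} (hij : i ≤ j) (hj : j ≤ p.length) :
    X.dist (p.getVert i) (p.getVert j) = j - i ∧
    ∃ q : X.Walk (p.getVert i) (p.getVert j), q.length = X.dist (p.getVert i) (p.getVert j) ∧
      ∀ s, s ∈ q.support ↔ ∃ k, i ≤ k ∧ k ≤ j ∧ p.getVert k = s := by
  obtain ⟨q, h1, h2, h3⟩ := p.exists_subwalk hij hj
  have h4 := length_eq_dist_of_subwalk hp h2
  exact ⟨h4 ▸ h1, q, h4, h3⟩

end SimpleGraph

/-- Used to choose the scale at which the logarithmic bound for guessed paths beats the linear one.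
-/
theorem exists_forall_linear_le_two_pow (a b : ℕ) : ∃ k₀ : ℕ, ∀ k ≥ k₀, a * k + b ≤ 2 ^ k := by
  refine ⟨a + b + 4, fun k hk => ?_⟩
  have h : k ^ 2 ≤ 2 ^ k := by
    have h4 : 4 ≤ k := by omega
    clear hk
    induction k, h4 using Nat.le_induction with
    | base => norm_num
    | succ n hn ih => rw [pow_succ 2]; nlinarith
  nlinarith

/-! ### Hyperbolicity by guessing geodesics -/

/-- A family of coarse paths in a graph, one for every pair of vertices, that form thin triangles:
the input of the criterion for hyperbolicity by guessing geodesics. -/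
structure IsThinPathFamily {V : Type*} (X : SimpleGraph V) (L : V → V → Set V) (D : ℕ) :
    Prop where
  subset : ∀ x y z, ∀ w ∈ L x y, ∃ w', (w' ∈ L x z ∨ w' ∈ L z y) ∧ X.dist w w' ≤ D
  short : ∀ x y, X.dist x y ≤ 1 → ∀ w ∈ L x y, X.dist w x ≤ D
  connected : ∀ x y, Relation.ReflTransGen
    (fun w w' => w ∈ L x y ∧ w' ∈ L x y ∧ X.dist w w' ≤ D) x y
  left_mem : ∀ x y, x ∈ L x y

namespace IsThinPathFamily

variable {V : Type*} {X : SimpleGraph V} {L : V → V → Set V} {D : ℕ}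

/-- Bisection: cutting the walk at its midpoint costs one thin triangle, hence `D`, and halves the
length. The bound is logarithmic in the length and holds for all walks. -/
theorem exists_dist_le_of_length_le (h : IsThinPathFamily X L D) (hX : X.Connected) (n : ℕ) :
    ∀ {x y : V} (p : X.Walk x y), p.length ≤ 2 ^ n → ∀ w ∈ L x y,
      ∃ a ∈ p.support, X.dist w a ≤ (n + 1) * D := by
  induction n with
  | zero =>
    intro x y p hp w hw
    refine ⟨x, p.start_mem_support, ?_⟩
    have := h.short x y ((X.dist_le p).trans (by simpa using hp)) w hw
    simpa using this
  | succ n ih =>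
    intro x y p hp w hw
    obtain ⟨q, hq, -, hqs⟩ := p.exists_subwalk (Nat.zero_le (p.length / 2)) (by omega)
    obtain ⟨r, hr, -, hrs⟩ := p.exists_subwalk (i := p.length / 2) (j := p.length) (by omega) le_rfl
    rw [pow_succ] at hp
    obtain ⟨w', hw', hd⟩ := h.subset x y (p.getVert (p.length / 2)) w hw
    have key : ∃ a ∈ p.support, X.dist w' a ≤ (n + 1) * D := by
      rcases hw' with hw' | hw'
      · obtain ⟨a, ha, hd⟩ := ih q (by omega) w' (by simpa using hw')
        obtain ⟨k, -, -, rfl⟩ := (hqs a).1 ha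
        exact ⟨_, p.getVert_mem_support k, hd⟩
      · obtain ⟨a, ha, hd⟩ := ih r (by omega) w' (by simpa using hw')
        obtain ⟨k, -, -, rfl⟩ := (hrs a).1 ha
        exact ⟨_, p.getVert_mem_support k, hd⟩
    obtain ⟨a, ha, hd'⟩ := key
    refine ⟨a, ha, (hX.dist_triangle (v := w')).trans ?_⟩
    linarith

/-- Bootstrapping: a bound `m + 1` can be lowered to `m` while `m` is large. It confines `w` to a
window of the geodesic of length about `4 * m`, and on this window the logarithmic bound is better
than `m`. -/
theorem exists_dist_le_pred (h : IsThinPathFamily X L D) (hX : X.Connected) {n m k : ℕ}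
    (hk : 4 * m + 4 * D + 6 ≤ 2 ^ k) (hm : (k + 3) * D ≤ m)
    (H : ∀ {x y : V} (p : X.Walk x y), p.length = X.dist x y → p.length ≤ n → ∀ w ∈ L x y,
      ∃ a ∈ p.support, X.dist w a ≤ m + 1)
    {x y : V} (p : X.Walk x y) (hp : p.length = X.dist x y) (hn : p.length ≤ n)
    {w : V} (hw : w ∈ L x y) : ∃ a ∈ p.support, X.dist w a ≤ m := by
  obtain ⟨a, ha, hwa⟩ := H p hp hn w hw
  obtain ⟨i, rfl, hi⟩ := SimpleGraph.Walk.mem_support_iff_exists_getVert.1 ha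
  have hm3 : 3 * D ≤ m := le_trans (Nat.mul_le_mul_right _ (by omega)) hm
  -- `T` exceeds the distance, at most `2 * (m + 1) + 2 * D`, between two points of `p` whose nearby
  -- path points are at most two thin triangles apart. The window has length at most `2 * T = 4 * m
  -- + 4 * D + 6`, the quantity in `hk`.
  set T := 2 * (m + 1) + 2 * D + 1 with hT
  obtain ⟨w₁, hw₁, hd₁⟩ := h.subset x y (p.getVert (i - T)) w hw
  have ht := fun u v w => hX.dist_triangle (u := u) (v := v) (w := w)
  rcases hw₁ with hw₁ | hw₁
  · obtain ⟨-, q, hq, hqs⟩ := p.exists_geodesic_subwalk hp (Nat.zero_le (i - T)) (by omega)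
    -- If `i ≤ T`, the truncated difference `i - T` is `0` and the left cut is at `x`, where the
    -- guessed path is short. Otherwise a path point left of the cut would be too far from `w`.
    by_cases hiT : i ≤ T
    · have h0 : i - T = 0 := by omega
      rw [h0] at hw₁
      simp only [SimpleGraph.Walk.getVert_zero] at hw₁
      have := h.short x x (by simp) w₁ hw₁
      exact ⟨x, p.start_mem_support, by linarith [ht w w₁ x]⟩
    · exfalso
      obtain ⟨hd0, -⟩ := p.exists_geodesic_subwalk hp (Nat.zero_le (i - T)) (by omega)
      obtain ⟨a, ha, hd⟩ := H q hq (by omega) w₁ (by simpa using hw₁)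
      obtain ⟨j, -, hj, rfl⟩ := (hqs a).1 ha
      obtain ⟨hd', -⟩ := p.exists_geodesic_subwalk hp (i := j) (j := i) (by omega) hi
      have h1 := ht (p.getVert j) w (p.getVert i)
      have h2 := ht w w₁ (p.getVert j)
      rw [X.dist_comm (u := p.getVert j) (v := w)] at h1
      omega
  · have hb : i ≤ min (i + T) p.length := by omega
    set b := min (i + T) p.length with hbdef
    obtain ⟨w₂, hw₂, hd₂⟩ := h.subset _ _ (p.getVert b) w₁ hw₁
    rcases hw₂ with hw₂ | hw₂
    · obtain ⟨hd0, q, hq, hqs⟩ := p.exists_geodesic_subwalk hp (i := i - T) (j := b)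
        (by omega) (by omega)
      obtain ⟨a, ha, hd⟩ := h.exists_dist_le_of_length_le hX k q (by omega) w₂ hw₂
      obtain ⟨j, -, hj, rfl⟩ := (hqs a).1 ha
      refine ⟨_, p.getVert_mem_support j, ?_⟩
      have h1 := ht w w₁ (p.getVert j)
      have h2 := ht w₁ w₂ (p.getVert j)
      linarith
    · obtain ⟨hd0, q, hq, hqs⟩ := p.exists_geodesic_subwalk hp (i := b) (j := p.length)
        (by omega) le_rfl
      by_cases hbl : b = p.length
      · rw [hbl] at hw₂
        simp only [SimpleGraph.Walk.getVert_length] at hw₂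
        have := h.short y y (by simp) w₂ hw₂
        exact ⟨y, p.end_mem_support, by linarith [ht w w₁ y, ht w₁ w₂ y]⟩
      · exfalso
        obtain ⟨a, ha, hd⟩ := H q hq (by omega) w₂ (by simpa using hw₂)
        obtain ⟨j, hj, hj', rfl⟩ := (hqs a).1 ha
        obtain ⟨hd', -⟩ := p.exists_geodesic_subwalk hp (i := i) (j := j) (by omega) hj'
        have h1 := ht (p.getVert i) w (p.getVert j)
        have h2 := ht w w₁ (p.getVert j)
        have h3 := ht w₁ w₂ (p.getVert j)
        rw [X.dist_comm (u := p.getVert i) (v := w)] at h1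
        omega

/-- The guessed paths are uniformly close to geodesics. -/
theorem exists_forall_dist_geodesic_le (h : IsThinPathFamily X L D) (hX : X.Connected) :
    ∃ R : ℕ, ∀ {x y : V} (p : X.Walk x y), p.length = X.dist x y → ∀ w ∈ L x y,
      ∃ a ∈ p.support, X.dist w a ≤ R := by
  obtain ⟨k₀, hk₀⟩ := exists_forall_linear_le_two_pow (4 * D) (24 * D + 6)
  -- For `D > 0` take `k = m / D - 3`, the largest value with `(k + 3) * D ≤ m`; then `m < (k + 4) *
  -- D`, so the other demand is linear in `k`.
  have hk : ∀ m ≥ (k₀ + 3) * D, ∃ k, 4 * m + 4 * D + 6 ≤ 2 ^ k ∧ (k + 3) * D ≤ m := by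
    intro m hm
    rcases Nat.eq_zero_or_pos D with rfl | hD
    · refine ⟨4 * m + 6, ?_, by simp⟩
      have := (Nat.lt_two_pow_self (n := 4 * m + 6)).le
      omega
    · have h1 := Nat.div_add_mod m D
      have h2 := Nat.mod_lt m hD
      have h3 : k₀ + 3 ≤ m / D := (Nat.le_div_iff_mul_le hD).2 hm
      obtain ⟨k, hk⟩ := Nat.exists_eq_add_of_le' (show 3 ≤ m / D by omega)
      have h4 := hk₀ k (by omega)
      rw [hk] at h1
      exact ⟨k, by nlinarith, hk ▸ Nat.div_mul_le_self m D⟩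
  refine ⟨(k₀ + 3) * D, fun {x y} p hp w hw => ?_⟩
  set n := p.length with hn
  -- The logarithmic bound, crudely `(n + 1) * D`, is lowered by one at a time to `(k₀ + 3) * D`,
  -- which does not depend on `n`. The length bound `n` stays fixed, as cutting a geodesic only
  -- shortens it.
  have key : ∀ j : ℕ, ∀ (x y : V) (p : X.Walk x y), p.length = X.dist x y → p.length ≤ n →
      ∀ w ∈ L x y, ∃ a ∈ p.support, X.dist w a ≤ (k₀ + 3) * D + ((n + 1) * D - j) := by
    intro j
    induction j with
    | zero =>
      intro x' y' p _ hn w hw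
      obtain ⟨a, ha, hd⟩ := h.exists_dist_le_of_length_le hX n p
        (hn.trans Nat.lt_two_pow_self.le) w hw
      exact ⟨a, ha, by omega⟩
    | succ j ih =>
      by_cases hj : (n + 1) * D ≤ j
      · intro x' y' p hp hn w hw
        obtain ⟨a, ha, hd⟩ := ih _ _ p hp hn w hw
        exact ⟨a, ha, by omega⟩
      · intro x' y' p hp hn w hw
        obtain ⟨k, h1, h2⟩ := hk ((k₀ + 3) * D + ((n + 1) * D - (j + 1))) (by omega)
        refine h.exists_dist_le_pred hX h1 h2 ?_ p hp hn hw
        intro x y p hp hn w hw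
        obtain ⟨a, ha, hd⟩ := ih _ _ p hp hn w hw
        exact ⟨a, ha, by omega⟩
  obtain ⟨a, ha, hd⟩ := key ((n + 1) * D) _ _ p hp le_rfl w hw
  exact ⟨a, ha, by omega⟩

/-- Geodesics are uniformly close to the guessed paths. -/
theorem exists_forall_geodesic_dist_le (h : IsThinPathFamily X L D) (hX : X.Connected) :
    ∃ R : ℕ, ∀ {x y : V} (p : X.Walk x y), p.length = X.dist x y → ∀ a ∈ p.support,
      ∃ w ∈ L x y, X.dist a w ≤ R := by
  obtain ⟨R, hR⟩ := h.exists_forall_dist_geodesic_le hX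
  refine ⟨3 * R + D, fun {x y} p hp a ha => ?_⟩
  obtain ⟨s, rfl, hs⟩ := SimpleGraph.Walk.mem_support_iff_exists_getVert.1 ha
  have ht := fun u v w => hX.dist_triangle (u := u) (v := v) (w := w)
  have hdist : ∀ i j, i ≤ j → j ≤ p.length → X.dist (p.getVert i) (p.getVert j) = j - i :=
    fun i j hij hj => (p.exists_geodesic_subwalk hp hij hj).1
  -- Follow the chain from `x` to `y`, each of whose points is within `R` of `p`. When the nearby
  -- point of `p` jumps past `s`, it jumps by at most `2 * R + D`, so the chain is within `3 * R +
  -- D` of `p.getVert s`. If it never jumps, `y` itself is close.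
  have key : ∀ w, Relation.ReflTransGen
      (fun w w' => w ∈ L x y ∧ w' ∈ L x y ∧ X.dist w w' ≤ D) x w →
      (∃ w' ∈ L x y, X.dist (p.getVert s) w' ≤ 3 * R + D) ∨
      ∃ t ≤ s, X.dist w (p.getVert t) ≤ R := by
    intro w hw
    induction hw with
    | refl => exact Or.inr ⟨0, by omega, by simp⟩
    | @tail w₁ w₂ _ hw ih =>
      rcases ih with ih | ⟨t, ht', hd⟩
      · exact Or.inl ih
      · obtain ⟨h1, h2, h3⟩ := hw
        obtain ⟨b, hb, hd'⟩ := hR p hp w₂ h2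
        obtain ⟨j, rfl, hj⟩ := SimpleGraph.Walk.mem_support_iff_exists_getVert.1 hb
        rcases le_total j s with hjs | hjs
        · exact Or.inr ⟨j, hjs, hd'⟩
        · left
          refine ⟨w₂, h2, ?_⟩
          have e1 := hdist t j (by omega) hj
          have e2 := hdist s j (by omega) hj
          have e3 := ht (p.getVert t) w₁ (p.getVert j)
          have e4 := ht w₁ w₂ (p.getVert j)
          have e5 := ht (p.getVert s) (p.getVert j) w₂
          rw [X.dist_comm (u := p.getVert t) (v := w₁)] at e3
          rw [X.dist_comm (u := p.getVert j) (v := w₂)] at e5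
          omega
  rcases key y (h.connected x y) with hk | ⟨t, hts, hd⟩
  · exact hk
  · have e1 := hdist t p.length (by omega) le_rfl
    have e2 := hdist s p.length hs le_rfl
    rw [p.getVert_length] at e1 e2
    rw [X.dist_comm] at hd
    have e3 : y ∈ L x y := by
      rcases Relation.ReflTransGen.cases_tail (h.connected x y) with h0 | ⟨_, _, h0⟩
      · subst h0; exact h.left_mem _ _
      · exact h0.2.1
    exact ⟨y, e3, by omega⟩

/-- Hyperbolicity by guessing geodesics. -/
theorem isGromovHyperbolicGraph (h : IsThinPathFamily X L D) (hX : X.Connected) :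
    IsGromovHyperbolicGraph X := by
  obtain ⟨R, hR⟩ := h.exists_forall_dist_geodesic_le hX
  obtain ⟨R', hR'⟩ := h.exists_forall_geodesic_dist_le hX
  refine ⟨hX, R' + D + R, fun x y z p q r hp hq hr a ha => ?_⟩
  obtain ⟨w, hw, hd⟩ := hR' p hp a ha
  obtain ⟨w', hw', hd'⟩ := h.subset x y z w hw
  have key : ∃ b, (b ∈ q.support ∨ b ∈ r.support) ∧ X.dist w' b ≤ R := by
    rcases hw' with hw' | hw'
    · obtain ⟨b, hb, hd⟩ := hR r hr w' hw'
      exact ⟨b, Or.inr hb, hd⟩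
    · obtain ⟨b, hb, hd⟩ := hR q.reverse (by rw [q.length_reverse, hq, X.dist_comm]) w' hw'
      exact ⟨b, Or.inl (by simpa using hb), hd⟩
  obtain ⟨b, hb, hd''⟩ := key
  refine ⟨b, hb, ?_⟩
  have h1 := hX.dist_triangle (u := a) (v := w) (w := b)
  have h2 := hX.dist_triangle (u := w) (v := w') (w := b)
  omega

end IsThinPathFamily

/-! ### Coarse retracts -/

theorem SimpleGraph.Connected.dist_map_le {V W : Type*} {X : SimpleGraph V} {Y : SimpleGraph W}
    (hX : X.Connected) (hY : Y.Connected) {f : V → W} {K : ℕ}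
    (hf : ∀ x y, X.Adj x y → Y.dist (f x) (f y) ≤ K) (x y : V) :
    Y.dist (f x) (f y) ≤ K * X.dist x y := by
  obtain ⟨p, hp⟩ := hX.exists_walk_length_eq_dist x y
  rw [← hp]
  clear hp
  induction p with
  | nil => simp
  | @cons u v w h p ih =>
    have := hY.dist_triangle (u := f u) (v := f v) (w := f w)
    have := hf _ _ h
    rw [SimpleGraph.Walk.length_cons]
    linarith

/-- A coarse Lipschitz retract of a hyperbolic graph is hyperbolic. -/
theorem IsGromovHyperbolicGraph.of_coarse_retract {V W : Type*} {X : SimpleGraph V}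
    {Y : SimpleGraph W} (hY : IsGromovHyperbolicGraph Y) (hX : X.Connected) {K : ℕ}
    (f : V → W) (r : W → V) (hf : ∀ x y, X.Adj x y → Y.dist (f x) (f y) ≤ K)
    (hr : ∀ x y, Y.Adj x y → X.dist (r x) (r y) ≤ K) (hrf : ∀ x, X.dist (r (f x)) x ≤ K) :
    IsGromovHyperbolicGraph X := by
  obtain ⟨hYc, δ, hδ⟩ := hY
  have hr' := hYc.dist_map_le hX hr
  have hf' := hX.dist_map_le hYc hf
  choose γ hγ using hYc.exists_walk_length_eq_dist
  -- The guessed paths are the images under `r` of chosen geodesics of `Y`. The endpoints are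
  -- adjoined because `r ∘ f` is only close to the identity.
  set L : V → V → Set V := fun x y => {x, y} ∪ r '' {a | a ∈ (γ (f x) (f y)).support} with hL
  -- `K * δ` serves the thin triangles, `K * K + K` the paths between neighbours, and `K` the steps
  -- of the chain.
  set D := K * (δ + K) + K + 1 with hD
  have hKD : K ≤ D := by rw [hD]; nlinarith
  refine IsThinPathFamily.isGromovHyperbolicGraph (L := L) (D := D) ⟨?_, ?_, ?_, ?_⟩ hX
  · rintro x y z w (hw | ⟨a, ha, rfl⟩)
    · refine ⟨w, ?_, by simp⟩
      rcases hw with rfl | hw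
      · simp [hL]
      · simp at hw
        simp [hL, hw]
    · obtain ⟨b, hb, hd⟩ := hδ _ _ _ (γ (f x) (f y)) (γ (f z) (f y)).reverse (γ (f x) (f z))
        (hγ _ _) (by rw [SimpleGraph.Walk.length_reverse, hγ, Y.dist_comm]) (hγ _ _) a ha
      refine ⟨r b, ?_, ?_⟩
      · rcases hb with hb | hb
        · exact Or.inr (Or.inr ⟨b, by simpa using hb, rfl⟩)
        · exact Or.inl (Or.inr ⟨b, hb, rfl⟩)
      · have := hr' a b
        nlinarith
  · intro x y hxy w hw
    rcases hw with hw | ⟨a, ha, rfl⟩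
    · rcases hw with rfl | hw
      · simp
      · simp only [Set.mem_singleton_iff] at hw
        rw [hw, X.dist_comm]
        omega
    · obtain ⟨i, rfl, hi⟩ := SimpleGraph.Walk.mem_support_iff_exists_getVert.1 ha
      have h1 := (SimpleGraph.Walk.exists_geodesic_subwalk (hγ (f x) (f y))
        (Nat.zero_le i) hi).1
      rw [SimpleGraph.Walk.getVert_zero, Y.dist_comm] at h1
      have h2 := hr' ((γ (f x) (f y)).getVert i) (f x)
      have h3 := hrf x
      have h4 := hX.dist_triangle (u := r ((γ (f x) (f y)).getVert i)) (v := r (f x)) (w := x)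
      have h5 := hf' x y
      rw [hγ] at hi
      have h6 : Y.dist ((γ (f x) (f y)).getVert i) (f x) ≤ K := by
        have := Nat.mul_le_mul_left K hxy
        omega
      have h7 := Nat.mul_le_mul_left K h6
      nlinarith
  · intro x y
    have hmem : ∀ a ∈ (γ (f x) (f y)).support, r a ∈ L x y := fun a ha => Or.inr ⟨a, ha, rfl⟩
    have hwalk : ∀ {a b : W} (p : Y.Walk a b), (∀ c ∈ p.support, r c ∈ L x y) →
        Relation.ReflTransGen
          (fun w w' => w ∈ L x y ∧ w' ∈ L x y ∧ X.dist w w' ≤ D) (r a) (r b) := by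
      intro a b p
      induction p with
      | nil => exact fun _ => .refl
      | @cons a b c h p ih =>
        intro hp
        simp only [SimpleGraph.Walk.support_cons, List.mem_cons, forall_eq_or_imp] at hp
        exact .head ⟨hp.1, hp.2 _ p.start_mem_support, (hr _ _ h).trans hKD⟩ (ih hp.2)
    refine .head ⟨by simp [hL], hmem _ (SimpleGraph.Walk.start_mem_support _), ?_⟩
      ((hwalk _ hmem).tail ⟨hmem _ (SimpleGraph.Walk.end_mem_support _), by simp [hL], ?_⟩)
    · rw [X.dist_comm]
      exact (hrf x).trans hKD
    · exact (hrf y).trans hKD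
  · intro x y
    simp [hL]

/-! ### Blocks and their retractions -/

/-- A retraction of a graph onto a set `P` of vertices that fixes the edges in `P` and collapses
all the other edges: the graph hangs together outside of `P` only through cut vertices in `P`. -/
structure IsBlockRetraction {V : Type*} (X : SimpleGraph V) (P : Set V) (ρ : V → V) : Prop where
  mem : ∀ v, ρ v ∈ P
  apply_of_mem : ∀ v ∈ P, ρ v = v
  adj : ∀ u v, X.Adj u v → (u ∈ P ∧ v ∈ P) ∨ ρ u = ρ v

namespace IsBlockRetraction

variable {V : Type*} {X : SimpleGraph V} {P : Set V} {ρ : V → V}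

/-- Apply `ρ` along the walk. Every edge not inside `P` is collapsed and costs one unit of length,
so a walk from `P` that loses no length never leaves `P`. -/
theorem exists_walk (h : IsBlockRetraction X P ρ) {x y : V} (p : X.Walk x y) :
    ∃ q : X.Walk (ρ x) (ρ y), (∀ s ∈ q.support, s ∈ P) ∧ q.length ≤ p.length ∧
      (q.length = p.length → x ∈ P → ∀ s ∈ p.support, s ∈ P) := by
  induction p with
  | nil => exact ⟨.nil, by simp [h.mem], by simp, by simp⟩
  | @cons x y z hxy p ih =>
    obtain ⟨q, h1, h2, h3⟩ := ih
    rcases h.adj x y hxy with ⟨hx, hy⟩ | he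
    · have hadj : X.Adj (ρ x) (ρ y) := by rwa [h.apply_of_mem x hx, h.apply_of_mem y hy]
      refine ⟨.cons hadj q, ?_, by simpa using h2, ?_⟩
      · simpa using ⟨h.mem x, h1⟩
      · intro hl _
        simpa using ⟨hx, h3 (by simpa using hl) hy⟩
    · rw [he]
      refine ⟨q, h1, by simp; omega, ?_⟩
      intro hl
      simp at hl
      omega

/-- Geodesics between vertices of a block stay in the block. -/
theorem support_subset (h : IsBlockRetraction X P ρ) {x y : V} (hx : x ∈ P) (hy : y ∈ P)
    {p : X.Walk x y} (hp : p.length = X.dist x y) : ∀ s ∈ p.support, s ∈ P := by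
  obtain ⟨q, -, h2, h3⟩ := h.exists_walk p
  refine h3 (le_antisymm h2 ?_) hx
  rw [hp]
  have := X.dist_le q
  have e : X.dist (ρ x) (ρ y) = X.dist x y := by
    rw [h.apply_of_mem x hx, h.apply_of_mem y hy]
  exact e ▸ this

/-- `ρ x` is the gate from `x` to the block: `ρ` is constant along the walk until it enters `P`, and
it fixes the vertex of entry. -/
theorem mem_support (h : IsBlockRetraction X P ρ) {x y : V} (p : X.Walk x y) (hy : y ∈ P) :
    ρ x ∈ p.support := by
  induction p with
  | nil => simp [h.apply_of_mem _ hy]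
  | @cons x y z hxy p ih =>
    by_cases hx : x ∈ P
    · simp [h.apply_of_mem x hx]
    · rcases h.adj x y hxy with h' | h'
      · exact absurd h'.1 hx
      · rw [h']
        simp [ih hy]

theorem apply_eq (h : IsBlockRetraction X P ρ) {x y : V} (p : X.Walk x y)
    (hp : ∀ s ∈ p.support, s ∉ P) : ρ x = ρ y := by
  induction p with
  | nil => rfl
  | @cons x y z hxy p ih =>
    simp only [SimpleGraph.Walk.support_cons, List.mem_cons, forall_eq_or_imp] at hp
    rcases h.adj x y hxy with h' | h'
    · exact absurd h'.1 hp.1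
    · rw [h', ih hp.2]

/-- The part of a geodesic in a block is a geodesic between the projections of the endpoints. -/
theorem exists_geodesic (h : IsBlockRetraction X P ρ) {x y : V} {p : X.Walk x y}
    (hp : p.length = X.dist x y) {v : V} (hv : v ∈ p.support) (hvP : v ∈ P) :
    ∃ q : X.Walk (ρ x) (ρ y), q.length = X.dist (ρ x) (ρ y) ∧ (∀ s ∈ q.support, s ∈ p.support) ∧
      ∀ s ∈ p.support, s ∈ P → s ∈ q.support := by
  -- The gate `ρ x` is passed before, and the gate `ρ y` after, any visit to `P`. A geodesic visits
  -- each gate only once, so its part in the block is the segment between them.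
  have hbefore : ∀ k ≤ p.length, p.getVert k ∈ P → ∃ i ≤ k, p.getVert i = ρ x := by
    intro k hk hkP
    obtain ⟨q, -, -, hqs⟩ := p.exists_subwalk (Nat.zero_le k) hk
    have := h.mem_support (q.copy p.getVert_zero rfl) hkP
    rw [SimpleGraph.Walk.support_copy, hqs] at this
    obtain ⟨i, -, hi, he⟩ := this
    exact ⟨i, hi, he⟩
  have hafter : ∀ k ≤ p.length, p.getVert k ∈ P → ∃ j, k ≤ j ∧ j ≤ p.length ∧
      p.getVert j = ρ y := by
    intro k hk hkP
    obtain ⟨q, -, -, hqs⟩ := p.exists_subwalk hk le_rfl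
    have := h.mem_support (q.copy rfl p.getVert_length).reverse hkP
    rw [SimpleGraph.Walk.support_reverse, List.mem_reverse, SimpleGraph.Walk.support_copy,
      hqs] at this
    obtain ⟨j, hj, hj', he⟩ := this
    exact ⟨j, hj, hj', he⟩
  obtain ⟨k, rfl, hk⟩ := SimpleGraph.Walk.mem_support_iff_exists_getVert.1 hv
  obtain ⟨i, hik, hi⟩ := hbefore k hk hvP
  obtain ⟨j, hkj, hj, hj'⟩ := hafter k hk hvP
  have hinj : ∀ a ≤ p.length, ∀ b ≤ p.length, p.getVert a = p.getVert b → a = b := by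
    intro a ha b hb hab
    rcases le_total a b with hle | hle
    · have := (p.exists_geodesic_subwalk hp hle hb).1
      rw [hab, X.dist_self] at this
      omega
    · have := (p.exists_geodesic_subwalk hp hle ha).1
      rw [hab, X.dist_self] at this
      omega
  obtain ⟨-, q, hq, hqs⟩ := p.exists_geodesic_subwalk hp (hik.trans hkj) hj
  refine ⟨q.copy hi hj', by rw [SimpleGraph.Walk.length_copy, hq, hi, hj'], ?_, ?_⟩
  · intro s hs
    rw [SimpleGraph.Walk.support_copy, hqs] at hs
    obtain ⟨l, -, -, rfl⟩ := hs
    exact p.getVert_mem_support l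
  · intro s hs hsP
    obtain ⟨l, rfl, hl⟩ := SimpleGraph.Walk.mem_support_iff_exists_getVert.1 hs
    rw [SimpleGraph.Walk.support_copy, hqs]
    obtain ⟨i', hi'l, hi'⟩ := hbefore l hl hsP
    obtain ⟨j', hlj, hj'l, hj''⟩ := hafter l hl hsP
    have e1 := hinj i (by omega) i' (by omega) (hi.trans hi'.symm)
    have e2 := hinj j (by omega) j' (by omega) (hj'.trans hj''.symm)
    exact ⟨l, by omega, by omega, rfl⟩

/-- A geodesic that misses the block projects to a single vertex; the constant walk there is a
degenerate side for the projected triangle. -/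
theorem exists_geodesic_or (h : IsBlockRetraction X P ρ) {x y : V} {p : X.Walk x y}
    (hp : p.length = X.dist x y) :
    ∃ q : X.Walk (ρ x) (ρ y), q.length = X.dist (ρ x) (ρ y) ∧
      ((∀ s ∈ q.support, s ∈ p.support) ∨ (ρ x = ρ y ∧ ∀ s ∈ q.support, s = ρ x)) := by
  by_cases hv : ∃ v ∈ p.support, v ∈ P
  · obtain ⟨v, hv, hvP⟩ := hv
    obtain ⟨q, h1, h2, -⟩ := h.exists_geodesic hp hv hvP
    exact ⟨q, h1, Or.inl h2⟩
  · push Not at hv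
    have he := h.apply_eq p hv
    exact ⟨SimpleGraph.Walk.nil.copy rfl he, by simp [he], Or.inr ⟨he, by simp⟩⟩

/-- If the geodesic triangles in a block are slim, so are the sides of arbitrary geodesic triangles
where they run through the block. -/
theorem slim (h : IsBlockRetraction X P ρ) {δ : ℕ}
    (hδ : ∀ {x y z : V} (p : X.Walk x y) (q : X.Walk y z) (r : X.Walk x z),
      x ∈ P → y ∈ P → z ∈ P →
      p.length = X.dist x y → q.length = X.dist y z → r.length = X.dist x z →
      ∀ a ∈ p.support, ∃ b, (b ∈ q.support ∨ b ∈ r.support) ∧ X.dist a b ≤ δ)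
    {x y z : V} (p : X.Walk x y) (q : X.Walk y z) (r : X.Walk x z)
    (hp : p.length = X.dist x y) (hq : q.length = X.dist y z) (hr : r.length = X.dist x z)
    {a a' : V} (ha : a ∈ p.support) (ha' : a' ∈ p.support) (haP : a ∈ P) (haP' : a' ∈ P)
    (hne : a ≠ a') : ∃ b, (b ∈ q.support ∨ b ∈ r.support) ∧ X.dist a b ≤ δ := by
  obtain ⟨p', hp', -, hpP⟩ := h.exists_geodesic hp ha haP
  obtain ⟨q', hq', hqq⟩ := h.exists_geodesic_or hq
  obtain ⟨r', hr', hrr⟩ := h.exists_geodesic_or hr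
  -- This is where two distinct vertices of `p` in the block are needed: it rules out that the
  -- projections of `q` and `r` are both degenerate.
  have hxy : ρ x ≠ ρ y := by
    intro he
    have h0 : X.dist (ρ x) (ρ y) = 0 := by rw [he, X.dist_self]
    have h0 : ∀ s ∈ p'.support, s = ρ x := by
      intro s hs
      obtain ⟨i, rfl, hi⟩ := SimpleGraph.Walk.mem_support_iff_exists_getVert.1 hs
      have : i = 0 := by omega
      rw [this, SimpleGraph.Walk.getVert_zero]
    exact hne ((h0 a (hpP a ha haP)).trans (h0 a' (hpP a' ha' haP')).symm)
  obtain ⟨b, hb, hd⟩ := hδ p' q' r' (h.mem _) (h.mem _) (h.mem _) hp' hq' hr' a (hpP a ha haP)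
  refine ⟨b, ?_, hd⟩
  -- A degenerate side is the single vertex `ρ z`, which is also an end of the other projected side
  -- and so lies on the other original side.
  rcases hqq with hqq | ⟨hyz, hqq⟩
  · rcases hrr with hrr | ⟨hxz, hrr⟩
    · exact hb.imp (hqq b) (hrr b)
    · refine Or.inl (hb.elim (hqq b) fun hb => ?_)
      rw [hrr b hb, hxz]
      exact hqq _ q'.end_mem_support
  · rcases hrr with hrr | ⟨hxz, hrr⟩
    · refine Or.inr (hb.elim (fun hb => ?_) (hrr b))
      rw [hqq b hb, hyz]
      exact hrr _ r'.end_mem_support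
    · exact absurd (hxz.trans hyz.symm) hxy

theorem connected_induce (h : IsBlockRetraction X P ρ) (hX : X.Connected) :
    (X.induce P).Connected := by
  have : Nonempty P := hX.nonempty.map fun v => ⟨ρ v, h.mem v⟩
  refine ⟨fun x y => ?_⟩
  obtain ⟨p, hp⟩ := hX.exists_walk_length_eq_dist x y
  exact ⟨p.induce P (h.support_subset x.2 y.2 hp)⟩

theorem dist_induce (h : IsBlockRetraction X P ρ) (hX : X.Connected) (x y : P) :
    (X.induce P).dist x y = X.dist x y := by
  apply le_antisymm
  · obtain ⟨p, hp⟩ := hX.exists_walk_length_eq_dist x y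
    rw [← hp]
    refine ((X.induce P).dist_le (p.induce P (h.support_subset x.2 y.2 hp))).trans_eq ?_
    rw [← SimpleGraph.Walk.length_map (SimpleGraph.Embedding.induce P).toHom,
      SimpleGraph.Walk.map_induce]
    rfl
  · obtain ⟨p, hp⟩ := (h.connected_induce hX).exists_walk_length_eq_dist x y
    rw [← hp, ← SimpleGraph.Walk.length_map (SimpleGraph.Embedding.induce P).toHom]
    exact X.dist_le _

/-- The blocks of a hyperbolic graph are hyperbolic. -/
theorem isGromovHyperbolicGraph_induce (h : IsBlockRetraction X P ρ)
    (hX : IsGromovHyperbolicGraph X) : IsGromovHyperbolicGraph (X.induce P) := by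
  obtain ⟨hc, δ, hδ⟩ := hX
  refine ⟨h.connected_induce hc, δ, fun x y z p q r hp hq hr a ha => ?_⟩
  rw [h.dist_induce hc] at hp hq hr
  let f := (SimpleGraph.Embedding.induce P (G := X)).toHom
  obtain ⟨b, hb, hd⟩ := hδ _ _ _ (p.map f) (q.map f) (r.map f) (by simpa using! hp)
    (by simpa using! hq) (by simpa using! hr) a (by
      rw [SimpleGraph.Walk.support_map]
      exact List.mem_map_of_mem ha)
  simp only [SimpleGraph.Walk.support_map, List.mem_map] at hb
  have key : ∃ b' : P, (b' ∈ q.support ∨ b' ∈ r.support) ∧ (b' : V) = b := by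
    rcases hb with ⟨b', hb, rfl⟩ | ⟨b', hb, rfl⟩
    · exact ⟨b', Or.inl hb, rfl⟩
    · exact ⟨b', Or.inr hb, rfl⟩
  obtain ⟨b', hb', rfl⟩ := key
  exact ⟨b', hb', by rwa [h.dist_induce hc]⟩

theorem exists_slim_of_induce (h : IsBlockRetraction X P ρ) (hX : X.Connected)
    (hP : IsGromovHyperbolicGraph (X.induce P)) :
    ∃ δ : ℕ, ∀ {x y z : V} (p : X.Walk x y) (q : X.Walk y z) (r : X.Walk x z),
      x ∈ P → y ∈ P → z ∈ P →
      p.length = X.dist x y → q.length = X.dist y z → r.length = X.dist x z →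
      ∀ a ∈ p.support, ∃ b, (b ∈ q.support ∨ b ∈ r.support) ∧ X.dist a b ≤ δ := by
  obtain ⟨-, δ, hδ⟩ := hP
  refine ⟨δ, fun {x y z} p q r hx hy hz hp hq hr a ha => ?_⟩
  have hlen : ∀ {x y : V} (p : X.Walk x y) (hp : ∀ s ∈ p.support, s ∈ P),
      (p.induce P hp).length = p.length := by
    intro x y p hp
    rw [← SimpleGraph.Walk.length_map (SimpleGraph.Embedding.induce P).toHom,
      SimpleGraph.Walk.map_induce]
    rfl
  have hpP := h.support_subset hx hy hp
  have hqP := h.support_subset hy hz hq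
  have hrP := h.support_subset hx hz hr
  obtain ⟨b, hb, hd⟩ := hδ _ _ _ (p.induce P hpP) (q.induce P hqP) (r.induce P hrP)
    (by rw [hlen, h.dist_induce hX, hp]) (by rw [hlen, h.dist_induce hX, hq])
    (by rw [hlen, h.dist_induce hX, hr]) ⟨a, hpP a ha⟩ (by simpa using ha)
  rw [h.dist_induce hX] at hd
  exact ⟨b, by simpa using hb, hd⟩

end IsBlockRetraction

theorem SimpleGraph.Connected.dist_smul {G V : Type*} [Group G] [MulAction G V]
    {X : SimpleGraph V} (hX : X.Connected)
    (hadj : ∀ (g : G) (x y : V), X.Adj x y → X.Adj (g • x) (g • y)) (g : G) (x y : V) :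
    X.dist (g • x) (g • y) = X.dist x y := by
  have key : ∀ (g : G) (x y : V), X.dist (g • x) (g • y) ≤ X.dist x y := by
    intro g x y
    have := hX.dist_map_le hX (f := fun v => g • v) (K := 1)
      (fun u v huv => (SimpleGraph.dist_eq_one_iff_adj.2 (hadj g u v huv)).le) x y
    simpa using this
  exact le_antisymm (key g x y) (by simpa using key g⁻¹ (g • x) (g • y))

/-- A graph with a group action is hyperbolic if every edge lies in a translate of one of finitely
many hyperbolic blocks. -/
theorem isGromovHyperbolicGraph_of_blocks {G V ι : Type*} [Group G] [MulAction G V] [Finite ι]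
    {X : SimpleGraph V} (hX : X.Connected)
    (hadj : ∀ (g : G) (x y : V), X.Adj x y → X.Adj (g • x) (g • y))
    (P : ι → Set V) (ρ : ι → V → V) (hρ : ∀ i, IsBlockRetraction X (P i) (ρ i))
    (hP : ∀ i, IsGromovHyperbolicGraph (X.induce (P i)))
    (hedge : ∀ x y, X.Adj x y → ∃ (i : ι) (g : G), g • x ∈ P i ∧ g • y ∈ P i) :
    IsGromovHyperbolicGraph X := by
  have hs := fun i => (hρ i).exists_slim_of_induce hX (hP i)
  choose δ hδ using hs
  obtain ⟨M, hM⟩ := (Set.finite_range δ).bddAbove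
  refine ⟨hX, M, fun x y z p q r hp hq hr a ha => ?_⟩
  -- The start `x` lies on `r`. Any other `a` has a preceding edge on `p`, and the translated block
  -- containing that edge contains two vertices of `p`, as `slim` requires.
  have hex : a = x ∨ ∃ a' ∈ p.support, X.Adj a a' := by
    obtain ⟨i, rfl, hi⟩ := SimpleGraph.Walk.mem_support_iff_exists_getVert.1 ha
    rcases i with _ | i
    · left; simp
    · exact Or.inr ⟨_, p.getVert_mem_support i, (p.adj_getVert_succ (by omega)).symm⟩
  rcases hex with rfl | ⟨a', ha', haa⟩
  · exact ⟨a, Or.inr r.start_mem_support, by simp⟩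
  · obtain ⟨i, g, hg, hg'⟩ := hedge a a' haa
    let f : X →g X := ⟨fun v => g • v, fun {u v} h => hadj g u v h⟩
    have hf : ∀ u v, X.dist (f u) (f v) = X.dist u v := hX.dist_smul hadj g
    obtain ⟨b, hb, hd⟩ := (hρ i).slim (hδ i) (p.map f) (q.map f) (r.map f)
      (by simpa [hf] using hp) (by simpa [hf] using hq) (by simpa [hf] using hr)
      (a := f a) (a' := f a') (by
        rw [SimpleGraph.Walk.support_map]
        exact List.mem_map_of_mem ha) (by
        rw [SimpleGraph.Walk.support_map]
        exact List.mem_map_of_mem ha') hg hg'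
      ((MulAction.injective g).ne haa.ne)
    simp only [SimpleGraph.Walk.support_map, List.mem_map] at hb
    have key : ∃ b', (b' ∈ q.support ∨ b' ∈ r.support) ∧ f b' = b := by
      rcases hb with ⟨b', hb, rfl⟩ | ⟨b', hb, rfl⟩
      · exact ⟨b', Or.inl hb, rfl⟩
      · exact ⟨b', Or.inr hb, rfl⟩
    obtain ⟨b', hb', rfl⟩ := key
    exact ⟨b', hb', by rw [hf] at hd; exact hd.trans (hM ⟨i, rfl⟩)⟩

/-! ### Proper orbit maps and the Milnor–Schwarz principle -/

open scoped Pointwise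

/-- A map from a topological group to the vertices of a graph that behaves like the orbit map of a
proper cobounded action. -/
structure IsProperOrbitMap {G : Type*} [Group G] [TopologicalSpace G] {V : Type*}
    (X : SimpleGraph V) (o : G → V) : Prop where
  cobounded : ∃ R : ℕ, ∀ v, ∃ g, X.dist v (o g) ≤ R
  proper : ∀ n : ℕ, ∃ Q : Set G, IsCompact Q ∧ ∀ g h, X.dist (o g) (o h) ≤ n → g⁻¹ * h ∈ Q
  bornologous : ∀ Q : Set G, IsCompact Q → ∃ K : ℕ, ∀ g h, g⁻¹ * h ∈ Q → X.dist (o g) (o h) ≤ K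

theorem IsProperOrbitMap.exists_lipschitz {G : Type*} [Group G] [TopologicalSpace G] {V W : Type*}
    {X : SimpleGraph V} {Y : SimpleGraph W} {o : G → V} {o' : G → W} (ho : IsProperOrbitMap X o)
    (ho' : IsProperOrbitMap Y o') (n : ℕ) :
    ∃ K : ℕ, ∀ g h, X.dist (o g) (o h) ≤ n → Y.dist (o' g) (o' h) ≤ K := by
  obtain ⟨Q, hQ, h1⟩ := ho.proper n
  obtain ⟨K, hK⟩ := ho'.bornologous Q hQ
  exact ⟨K, fun g h hgh => hK g h (h1 g h hgh)⟩

/-- The Milnor–Schwarz principle: hyperbolicity of a graph on which a group acts properly and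
coboundedly depends only on the group. -/
theorem IsProperOrbitMap.isGromovHyperbolicGraph {G : Type*} [Group G] [TopologicalSpace G]
    {V W : Type*} {X : SimpleGraph V} {Y : SimpleGraph W} {o : G → V} {o' : G → W}
    (ho : IsProperOrbitMap X o) (ho' : IsProperOrbitMap Y o') (hX : X.Connected)
    (hY : IsGromovHyperbolicGraph Y) : IsGromovHyperbolicGraph X := by
  obtain ⟨R, hR⟩ := ho.cobounded
  obtain ⟨R', hR'⟩ := ho'.cobounded
  choose f hf using hR
  choose r hr using hR'
  obtain ⟨K₁, hK₁⟩ := ho.exists_lipschitz ho' (2 * R + 1)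
  obtain ⟨K₂, hK₂⟩ := ho'.exists_lipschitz ho (2 * R' + 1)
  have hlip : ∀ x y, X.Adj x y → X.dist (o (f x)) (o (f y)) ≤ 2 * R + 1 := by
    intro x y h
    have h1 := hX.dist_triangle (u := o (f x)) (v := x) (w := o (f y))
    have h2 := hX.dist_triangle (u := x) (v := y) (w := o (f y))
    have h3 := SimpleGraph.dist_eq_one_iff_adj.2 h
    have h4 := hf x
    have h5 := hf y
    rw [X.dist_comm] at h4
    omega
  have hlip' : ∀ x y, Y.Adj x y → Y.dist (o' (r x)) (o' (r y)) ≤ 2 * R' + 1 := by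
    intro x y h
    have h1 := hY.1.dist_triangle (u := o' (r x)) (v := x) (w := o' (r y))
    have h2 := hY.1.dist_triangle (u := x) (v := y) (w := o' (r y))
    have h3 := SimpleGraph.dist_eq_one_iff_adj.2 h
    have h4 := hr x
    have h5 := hr y
    rw [Y.dist_comm] at h4
    omega
  refine hY.of_coarse_retract hX (K := K₁ + K₂ + R) (fun x => o' (f x)) (fun y => o (r y))
    (fun x y h => (hK₁ _ _ (hlip x y h)).trans (by omega))
    (fun x y h => (hK₂ _ _ (hlip' x y h)).trans (by omega)) (fun x => ?_)
  have h1 := hX.dist_triangle (u := o (r (o' (f x)))) (v := o (f x)) (w := x)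
  have h2 := hK₂ (f x) (r (o' (f x))) ((hr _).trans (by omega))
  have h3 := hf x
  rw [X.dist_comm] at h2 h3
  omega

theorem SimpleGraph.Connected.finite_setOf_dist_le {V : Type*} {X : SimpleGraph V}
    (hX : X.Connected) (hfin : ∀ x : V, (X.neighborSet x).Finite) (x : V) (n : ℕ) :
    {y | X.dist x y ≤ n}.Finite := by
  induction n with
  | zero =>
    refine (Set.finite_singleton x).subset fun y hy => ?_
    exact ((hX.dist_eq_zero_iff).1 (Nat.le_zero.1 hy)).symm
  | succ n ih =>
    refine (ih.union (ih.biUnion fun y _ => hfin y)).subset fun y hy => ?_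
    by_cases hyn : X.dist x y ≤ n
    · exact Or.inl hyn
    · right
      obtain ⟨p, hp⟩ := hX.exists_walk_length_eq_dist x y
      have hl : p.length = n + 1 := by
        have : X.dist x y ≤ n + 1 := hy
        omega
      refine Set.mem_biUnion (x := p.getVert n) ?_ ?_
      · have := (p.exists_geodesic_subwalk hp (Nat.zero_le n) (by omega)).1
        rw [p.getVert_zero] at this
        exact this.le
      · have := p.adj_getVert_succ (i := n) (by omega)
        rw [← hl, p.getVert_length] at this
        exact this

/-! ### Coset graphs as Cayley–Abels graphs -/

section CayleyAbels

variable {G : Type*} [Group G] [TopologicalSpace G] [IsTopologicalGroup G]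

/-- The distance from `g • x` to `k • x` depends only on `g⁻¹ * k`. Balls are finite, so bounding it
leaves finitely many cosets of the compact stabilizer; the stabilizer is open, so the orbit map is
locally constant and bounded on compact sets. -/
theorem IsCayleyAbelsGraph.isProperOrbitMap {V : Type*} [MulAction G V] {X : SimpleGraph V}
    (h : IsCayleyAbelsGraph G X) (x : V) : IsProperOrbitMap X (fun g : G => g • x) := by
  have hd := h.connected.dist_smul h.smul_adj
  have hdist : ∀ g k : G, X.dist (g • x) (k • x) = X.dist x ((g⁻¹ * k) • x) := by
    intro g k
    rw [← hd g⁻¹, inv_smul_smul, mul_smul]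
  refine ⟨⟨0, fun v => ?_⟩, fun n => ?_, fun Q hQ => ?_⟩
  · obtain ⟨g, rfl⟩ := h.transitive x v
    exact ⟨g, by simp⟩
  · refine ⟨⋃ y ∈ {y | X.dist x y ≤ n}, {g : G | g • x = y}, ?_, fun g k hgk => ?_⟩
    · refine (h.connected.finite_setOf_dist_le h.locallyFinite x n).isCompact_biUnion fun y _ => ?_
      obtain ⟨g, rfl⟩ := h.transitive x y
      have : {k : G | k • x = g • x} = g • (MulAction.stabilizer G x : Set G) := by
        ext k
        rw [Set.mem_smul_set_iff_inv_smul_mem]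
        simp [MulAction.mem_stabilizer_iff, mul_smul, inv_smul_eq_iff]
      rw [this]
      exact (h.isCompact_stabilizer x).smul g
    · rw [hdist] at hgk
      exact Set.mem_biUnion hgk rfl
  · have hlc : IsLocallyConstant fun g : G => g • x := by
      rw [IsLocallyConstant.iff_exists_open]
      intro g
      refine ⟨g • (MulAction.stabilizer G x : Set G), (h.isOpen_stabilizer x).smul g,
        ⟨1, one_mem _, by simp⟩, ?_⟩
      rintro _ ⟨k, hk, rfl⟩
      change (g * k) • x = g • x
      rw [mul_smul, MulAction.mem_stabilizer_iff.1 hk]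
    obtain ⟨K, hK⟩ := (hQ.image (hlc.comp (X.dist x)).continuous).bddAbove
    exact ⟨K, fun g k hgk => by rw [hdist]; exact hK ⟨_, hgk, rfl⟩⟩

/-- The graph on the cosets of `C` with the edges from `g C` to `g s C` for `s` in `S`. -/
def cosetGraph {G : Type*} [Group G] (C : Subgroup G) (S : Set G) : SimpleGraph (G ⧸ C) :=
  SimpleGraph.fromRel fun x y => ∃ g : G, ∃ s ∈ S, x = (g : G ⧸ C) ∧ y = ((g * s : G) : G ⧸ C)

theorem cosetGraph_smul_adj {G : Type*} [Group G] (C : Subgroup G) (S : Set G) (g : G)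
    (x y : G ⧸ C) (h : (cosetGraph C S).Adj x y) : (cosetGraph C S).Adj (g • x) (g • y) := by
  have key : ∀ x y : G ⧸ C, (∃ k : G, ∃ s ∈ S, x = (k : G ⧸ C) ∧ y = ((k * s : G) : G ⧸ C)) →
      ∃ k : G, ∃ s ∈ S, g • x = (k : G ⧸ C) ∧ g • y = ((k * s : G) : G ⧸ C) := by
    rintro _ _ ⟨k, s, hs, rfl, rfl⟩
    exact ⟨g * k, s, hs, rfl, by rw [mul_assoc]; rfl⟩
  rw [cosetGraph, SimpleGraph.fromRel_adj] at h ⊢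
  exact ⟨(MulAction.injective g).ne h.1, h.2.imp (key _ _) (key _ _)⟩

theorem cosetGraph_connected {G : Type*} [Group G] {C : Subgroup G} {S : Set G}
    (h : Subgroup.closure (C ∪ S) = ⊤) : (cosetGraph C S).Connected := by
  -- Reachability is asked from every `k`, since edges come from right multiplication; this makes
  -- the condition closed under products.
  let H : Subgroup G :=
    { carrier := {g | ∀ k : G, (cosetGraph C S).Reachable (k : G ⧸ C) ((k * g : G) : G ⧸ C)}
      mul_mem' := by
        intro a b ha hb k
        rw [← mul_assoc]
        exact (ha k).trans (hb _)
      one_mem' := by simp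
      inv_mem' := by
        intro a ha k
        simpa using (ha (k * a⁻¹)).symm }
  have hH : H = ⊤ := by
    rw [eq_top_iff, ← h, Subgroup.closure_le]
    rintro g (hg | hg) k
    · have : ((k * g : G) : G ⧸ C) = k := by
        rw [eq_comm, QuotientGroup.eq]; simpa using hg
      rw [this]
    · by_cases he : (k : G ⧸ C) = ((k * g : G) : G ⧸ C)
      · rw [← he]
      · refine SimpleGraph.Adj.reachable ?_
        rw [cosetGraph, SimpleGraph.fromRel_adj]
        exact ⟨he, Or.inl ⟨k, g, hg, rfl, rfl⟩⟩
  refine ⟨fun x y => ?_⟩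
  induction x using QuotientGroup.induction_on with | H x => ?_
  induction y using QuotientGroup.induction_on with | H y => ?_
  have : x⁻¹ * y ∈ H := by rw [hH]; trivial
  simpa using this x

theorem isCayleyAbelsGraph_cosetGraph {C : Subgroup G} {S : Set G} (hCo : IsOpen (C : Set G))
    (hCc : IsCompact (C : Set G)) (hS : IsCompact S) (h : Subgroup.closure (C ∪ S) = ⊤) :
    IsCayleyAbelsGraph G (cosetGraph C S) := by
  have hdisc : DiscreteTopology (G ⧸ C) := QuotientGroup.discreteTopology hCo
  have hfin : ∀ Q : Set G, IsCompact Q → (((↑) : G → G ⧸ C) '' Q).Finite := fun Q hQ =>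
    (hQ.image QuotientGroup.continuous_mk).finite_of_discrete
  refine ⟨cosetGraph_connected h, ?_, cosetGraph_smul_adj C S, ?_, ?_, ?_⟩
  · intro x
    induction x using QuotientGroup.induction_on with | H x => ?_
    -- The neighbours of `xC` are cosets of elements of the compact sets `xCS` and `xCS⁻¹`, which
    -- have finite image in the discrete space `G ⧸ C`.
    refine ((hfin _ ((isCompact_singleton (x := x)).mul (hCc.mul hS))).union
      (hfin _ ((isCompact_singleton (x := x)).mul (hCc.mul hS.inv)))).subset ?_
    intro y hy
    rw [SimpleGraph.mem_neighborSet, cosetGraph, SimpleGraph.fromRel_adj] at hy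
    obtain ⟨-, ⟨g, s, hs, hxg, rfl⟩ | ⟨g, s, hs, rfl, hxg⟩⟩ := hy
    · rw [QuotientGroup.eq] at hxg
      exact Or.inl ⟨g * s, ⟨x, rfl, _, ⟨_, hxg, s, hs, rfl⟩, by simp [mul_assoc]⟩, rfl⟩
    · rw [QuotientGroup.eq] at hxg
      exact Or.inr ⟨g, ⟨x, rfl, _, ⟨_, hxg, s⁻¹, Set.inv_mem_inv.2 hs, rfl⟩,
        by simp [mul_assoc]⟩, rfl⟩
  · exact MulAction.exists_smul_eq G
  · intro x
    induction x using QuotientGroup.induction_on with | H x => ?_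
    have : (MulAction.stabilizer G (x : G ⧸ C) : Set G) = (fun c => x * c * x⁻¹) '' C := by
      ext g
      rw [SetLike.mem_coe, MulAction.mem_stabilizer_iff]
      change ((g * x : G) : G ⧸ C) = x ↔ _
      rw [eq_comm, QuotientGroup.eq]
      constructor
      · intro hg
        exact ⟨_, hg, by group⟩
      · rintro ⟨c, hc, rfl⟩
        simpa [mul_assoc] using hc
    rw [this]
    exact hCc.image (by fun_prop)
  · intro x
    induction x using QuotientGroup.induction_on with | H x => ?_
    have hc : Continuous fun g : G => ((g * x : G) : G ⧸ C) :=
      QuotientGroup.continuous_mk.comp (by fun_prop)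
    exact (isOpen_discrete {(x : G ⧸ C)}).preimage hc

end CayleyAbels

/-- Hyperbolicity of a group can be tested on every one of its coset graphs. -/
theorem isHyperbolicTDLCGroup_iff_cosetGraph {G : Type u} [Group G] [TopologicalSpace G]
    (hG : IsTDLCGroup G) {C : Subgroup G} {S : Set G} (hCo : IsOpen (C : Set G))
    (hCc : IsCompact (C : Set G)) (hS : IsCompact S) (h : Subgroup.closure (C ∪ S) = ⊤) :
    IsHyperbolicTDLCGroup G ↔ IsGromovHyperbolicGraph (cosetGraph C S) := by
  have := hG.isTopologicalGroup
  have hZ := isCayleyAbelsGraph_cosetGraph hCo hCc hS h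
  constructor
  · rintro ⟨-, -, V, _, X, hX, hyp⟩
    obtain ⟨x⟩ := hX.connected.nonempty
    exact (hZ.isProperOrbitMap ((1 : G) : G ⧸ C)).isGromovHyperbolicGraph (hX.isProperOrbitMap x)
      hZ.connected hyp
  · intro hyp
    exact ⟨hG, ⟨_, hCc.union hS, h⟩, _, _, _, hZ, hyp⟩

/-- A topological group with a TDLC open subgroup is TDLC. -/
theorem IsTDLCGroup.of_isOpenEmbedding {A G : Type*} [Group A] [TopologicalSpace A] [Group G]
    [TopologicalSpace G] [IsTopologicalGroup G] (hA : IsTDLCGroup A) (i : A →* G)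
    (hi : IsOpenEmbedding i) : IsTDLCGroup G := by
  have := hA.t2Space
  have := hA.locallyCompactSpace
  have := hA.totallyDisconnectedSpace
  have hopen : IsOpen (i.range : Set G) := hi.isOpen_range
  have hclosed : IsClosed (i.range : Set G) := i.range.isClosed_of_isOpen hopen
  have hmul : ∀ g : G, IsOpenEmbedding fun a => g * i a := fun g =>
    (Homeomorph.mulLeft g).isOpenEmbedding.comp hi
  have hsing : IsClosed ({1} : Set G) := by
    have he : ({1} : Set G) = i '' {1} := by simp
    rw [he]
    exact ((⟨hi.isEmbedding, hclosed⟩ : IsClosedEmbedding i).isClosedMap) _ isClosed_singleton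
  refine ⟨inferInstance, ?_, ?_, ⟨?_⟩⟩
  · have : T1Space G := IsTopologicalGroup.t1Space G hsing
    infer_instance
  · obtain ⟨K, hK, hK1⟩ := exists_compact_mem_nhds (1 : A)
    refine IsCompact.locallyCompactSpace_of_mem_nhds_of_group (hK.image hi.continuous) (x := 1) ?_
    rw [← map_one i]
    exact hi.isOpenMap.image_mem_nhds hK1
  · intro t _ ht x hx y hy
    -- The coset of `x` is clopen, so it contains the preconnected set `t`, which can be pulled back
    -- to the totally disconnected group `A`.
    have hcl : IsClopen ((fun a => x * i a) '' Set.univ) := by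
      refine ⟨?_, (hmul x).isOpenMap _ isOpen_univ⟩
      have : (fun a => x * i a) '' Set.univ = (fun g => x * g) '' (i.range : Set G) := by
        ext; simp [eq_inv_mul_iff_mul_eq]
      rw [this]
      exact (Homeomorph.mulLeft x).isClosedMap _ hclosed
    have hsub := ht.subset_isClopen hcl ⟨x, hx, 1, trivial, by simp⟩
    have hpre : IsPreconnected ((fun a => x * i a) ⁻¹' t) := by
      refine ht.preimage_of_isOpenMap (hmul x).injective (hmul x).isOpenMap ?_
      simpa using hsub
    obtain ⟨a, -, rfl⟩ := hsub hy
    have : (1 : A) = a := hpre.subsingleton (by simpa using hx) hy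
    simp [← this]

/-- A block of a Cayley–Abels graph of `G` that is close to an orbit of an open subgroup `A`
computes hyperbolicity of `A`. -/
theorem isHyperbolicTDLCGroup_iff_block {A : Type u} [Group A] [TopologicalSpace A]
    {G V : Type*} [Group G] [TopologicalSpace G] [IsTopologicalGroup G] [MulAction G V]
    (hA : IsTDLCGroup A) (hAc : IsCompactlyGeneratedGroup A) {C : Subgroup A}
    (hCo : IsOpen (C : Set A)) (hCc : IsCompact (C : Set A)) (i : A →* G) (hi : IsOpenEmbedding i)
    {X : SimpleGraph V} (hX : IsCayleyAbelsGraph G X) {P : Set V} {ρ : V → V}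
    (hρ : IsBlockRetraction X P ρ) (x : V) (hx : ∀ a, i a • x ∈ P) (R : ℕ)
    (hR : ∀ v ∈ P, ∃ a, X.dist v (i a • x) ≤ R) :
    IsHyperbolicTDLCGroup A ↔ IsGromovHyperbolicGraph (X.induce P) := by
  have := hA.isTopologicalGroup
  obtain ⟨K, hK, hgen⟩ := hAc
  have hgen' : Subgroup.closure (C ∪ K) = ⊤ :=
    top_le_iff.1 (hgen ▸ Subgroup.closure_mono Set.subset_union_right)
  have hY := isCayleyAbelsGraph_cosetGraph hCo hCc hK hgen'
  have hoY := hY.isProperOrbitMap ((1 : A) : A ⧸ C)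
  have hoX := hX.isProperOrbitMap x
  have hclosed : IsClosedEmbedding i :=
    ⟨hi.isEmbedding, i.range.isClosed_of_isOpen hi.isOpen_range⟩
  have hd := hρ.dist_induce hX.connected
  have hmul : ∀ a b, (i a)⁻¹ * i b = i (a⁻¹ * b) := by simp
  -- All three properties come from the orbit map of `G`: the block is isometrically embedded, and
  -- `i` is a closed embedding, so preimages of compact sets are compact.
  have ho : IsProperOrbitMap (X.induce P) (fun a => (⟨i a • x, hx a⟩ : P)) := by
    refine ⟨⟨R, fun v => ?_⟩, fun n => ?_, fun Q hQ => ?_⟩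
    · obtain ⟨a, ha⟩ := hR v v.2
      exact ⟨a, by rwa [hd]⟩
    · obtain ⟨Q, hQ, h⟩ := hoX.proper n
      refine ⟨i ⁻¹' Q, hclosed.isCompact_preimage hQ, fun a b hab => ?_⟩
      rw [hd] at hab
      rw [Set.mem_preimage, ← hmul]
      exact h _ _ hab
    · obtain ⟨K, hK⟩ := hoX.bornologous _ (hQ.image hi.continuous)
      refine ⟨K, fun a b hab => ?_⟩
      rw [hd]
      exact hK _ _ (by rw [hmul]; exact ⟨_, hab, rfl⟩)
  rw [isHyperbolicTDLCGroup_iff_cosetGraph hA hCo hCc hK hgen']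
  exact ⟨ho.isGromovHyperbolicGraph hoY (hρ.connected_induce hX.connected),
    hoY.isGromovHyperbolicGraph ho hY.connected⟩

/-! ### Reduced decompositions in amalgams from permutation actions -/

theorem IsBlockRetraction.cosetGraph {G : Type*} [Group G] {C : Subgroup G} {S : Set G}
    {P : Set (G ⧸ C)} {ρ : G ⧸ C → G ⧸ C} (hmem : ∀ v, ρ v ∈ P) (hself : ∀ v ∈ P, ρ v = v)
    (hadj : ∀ g : G, ∀ s ∈ S, ((g : G ⧸ C) ∈ P ∧ ((g * s : G) : G ⧸ C) ∈ P) ∨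
      ρ (g : G ⧸ C) = ρ ((g * s : G) : G ⧸ C)) :
    IsBlockRetraction (cosetGraph C S) P ρ := by
  refine ⟨hmem, hself, fun x y h => ?_⟩
  obtain ⟨-, ⟨g, s, hs, rfl, rfl⟩ | ⟨g, s, hs, rfl, rfl⟩⟩ := SimpleGraph.fromRel_adj _ _ _ |>.1 h
  · exact hadj g s hs
  · exact (hadj g s hs).imp And.symm Eq.symm

theorem Subgroup.induction_of_closure_union {G : Type*} [Group G] {S T : Set G}
    (h : Subgroup.closure (S ∪ T) = ⊤) {p : G → Prop} (one : p 1)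
    (hS : ∀ s ∈ S, ∀ u, p u → p (s * u)) (hS' : ∀ s ∈ S, ∀ u, p u → p (s⁻¹ * u))
    (hT : ∀ s ∈ T, ∀ u, p u → p (s * u)) (hT' : ∀ s ∈ T, ∀ u, p u → p (s⁻¹ * u)) (u : G) :
    p u := by
  have hu : u ∈ Subgroup.closure (S ∪ T) := h ▸ Subgroup.mem_top u
  induction hu using Subgroup.closure_induction_left with
  | one => exact one
  | mul_left x hx y _ ih => exact hx.elim (fun hx => hS x hx y ih) (fun hx => hT x hx y ih)
  | inv_mul_cancel x hx y _ ih =>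
    exact hx.elim (fun hx => hS' x hx y ih) (fun hx => hT' x hx y ih)

/-- Left translations of `G`, acting on `G × M`. -/
def translationPerm (G M : Type*) [Group G] : G →* Equiv.Perm (G × M) where
  toFun u := ⟨fun p => (u * p.1, p.2), fun p => (u⁻¹ * p.1, p.2), fun p => by simp,
    fun p => by simp⟩
  map_one' := by ext p <;> simp
  map_mul' u v := by ext p <;> simp [mul_assoc]

@[simp] theorem translationPerm_apply {G M : Type*} [Group G] (u : G) (p : G × M) :
    translationPerm G M u p = (u * p.1, p.2) := rfl

/-- The shear of `G × M` along a function from `G` to `M`. -/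
def shearPerm {G M : Type*} [AddCommGroup M] (F : G → M) : Equiv.Perm (G × M) :=
  ⟨fun p => (p.1, p.2 + F p.1), fun p => (p.1, p.2 - F p.1), fun p => by simp, fun p => by simp⟩

@[simp] theorem shearPerm_apply {G M : Type*} [AddCommGroup M] (F : G → M) (p : G × M) :
    shearPerm F p = (p.1, p.2 + F p.1) := rfl

@[simp] theorem shearPerm_symm_apply {G M : Type*} [AddCommGroup M] (F : G → M) (p : G × M) :
    (shearPerm F).symm p = (p.1, p.2 - F p.1) := rfl

section Amalgam

variable {G : Type*} [Group G] {H K C : Subgroup G}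

/-- In an amalgamated product of `H` and `K` over `C` the coset `h C` in the first factor of a
reduced decomposition `h k ...` is well defined. -/
theorem exists_first_coset_of_amalgam (hCH : C ≤ H)
    (hgen : Subgroup.closure ((H : Set G) ∪ K) = ⊤)
    (hlift : ∀ Φ₁ Φ₂ : G →* Equiv.Perm (G × (G ⧸ C →₀ ℤ)), (∀ c ∈ C, Φ₁ c = Φ₂ c) →
      ∃ Φ : G →* Equiv.Perm (G × (G ⧸ C →₀ ℤ)), (∀ h ∈ H, Φ h = Φ₁ h) ∧ ∀ k ∈ K, Φ k = Φ₂ k) :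
    ∃ ρ : G → G ⧸ C, (∀ g, ∃ h ∈ H, ρ g = h) ∧ (∀ h ∈ H, ρ h = h) ∧
      (∀ g, ∀ k ∈ K, ρ (g * k) = ρ g) ∧ ∀ g ∉ H, ∀ h ∈ H, ρ (g * h) = ρ g := by
  classical
  -- Values are taken in the free abelian group on the cosets so that they can be added and
  -- subtracted; a coset is recovered from its basis vector.
  let F : G → (G ⧸ C →₀ ℤ) := fun g => if g ∈ H then Finsupp.single ((g⁻¹ : G) : G ⧸ C) 1 else 0
  have hF : ∀ h ∈ H, F h = Finsupp.single ((h⁻¹ : G) : G ⧸ C) 1 := fun h hh => if_pos hh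
  have hF0 : ∀ g ∉ H, F g = 0 := fun h hh => if_neg hh
  have hFC : ∀ c ∈ C, ∀ g, F (c * g) = F g := by
    intro c hc g
    by_cases hg : g ∈ H
    · rw [hF _ hg, hF _ (mul_mem (hCH hc) hg)]
      congr 1
      rw [QuotientGroup.eq]
      simpa using hc
    · rw [hF0 _ hg, hF0 _ fun h => hg ((H.mul_mem_cancel_left (hCH hc)).1 h)]
  -- `H` acts by translations conjugated by the shear along `F`, and `K` by plain translations. They
  -- agree on `C` because `F` is invariant under left multiplication by `C`.
  obtain ⟨Φ, hΦH, hΦK⟩ := hlift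
    ((MulAut.conj (shearPerm F)).toMonoidHom.comp (translationPerm G _)) (translationPerm G _) (by
      intro c hc
      ext p <;> simp [hFC c hc])
  have hH : ∀ h ∈ H, ∀ p, Φ h p = (h * p.1, p.2 - F p.1 + F (h * p.1)) := by
    intro h hh p
    simp [hΦH h hh]
  have hK : ∀ k ∈ K, ∀ p, Φ k p = (k * p.1, p.2) := by
    intro k hk p
    simp [hΦK k hk]
  have hfst : ∀ u p, (Φ u p).1 = u * p.1 := by
    have e1 : ∀ h ∈ H, ∀ u, (∀ p, (Φ u p).1 = u * p.1) → ∀ p, (Φ (h * u) p).1 = h * u * p.1 := by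
      intro h hh u hu p
      rw [map_mul, Equiv.Perm.mul_apply, hH h hh, hu, mul_assoc]
    have e2 : ∀ k ∈ K, ∀ u, (∀ p, (Φ u p).1 = u * p.1) → ∀ p, (Φ (k * u) p).1 = k * u * p.1 := by
      intro k hk u hu p
      rw [map_mul, Equiv.Perm.mul_apply, hK k hk, hu, mul_assoc]
    exact Subgroup.induction_of_closure_union hgen (by simp) e1 (fun h hh => e1 _ (inv_mem hh)) e2
      (fun k hk => e2 _ (inv_mem hk))
  -- `φ` agrees with `F` on `H`, and is unchanged by left multiplication by `K`, and by `H` outside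
  -- of `H`. So `φ u` is the inverse coset of the last factor of `u`, if that is in `H`.
  let φ : G → (G ⧸ C →₀ ℤ) := fun u => (Φ u (1, F 1)).2
  have hφH : ∀ h ∈ H, ∀ u, φ (h * u) = φ u - F u + F (h * u) := by
    intro h hh u
    change (Φ (h * u) (1, F 1)).2 = _
    rw [map_mul, Equiv.Perm.mul_apply, hH h hh, hfst, mul_one]
  have hφK : ∀ k ∈ K, ∀ u, φ (k * u) = φ u := by
    intro k hk u
    change (Φ (k * u) (1, F 1)).2 = _
    rw [map_mul, Equiv.Perm.mul_apply, hK k hk]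
  have hφ1 : φ 1 = F 1 := by simp [φ]
  have hφF : ∀ h ∈ H, φ h = F h := by
    intro h hh
    have := hφH h hh 1
    rwa [hφ1, sub_self, zero_add, mul_one] at this
  have hφH' : ∀ h ∈ H, ∀ u ∉ H, φ (h * u) = φ u := by
    intro h hh u hu
    rw [hφH h hh, hF0 _ hu, hF0 _ fun h' => hu ((H.mul_mem_cancel_left hh).1 h')]
    simp
  have hex : ∀ u, ∃ h ∈ H, φ u = Finsupp.single (h : G ⧸ C) 1 := by
    have e1 : ∀ h ∈ H, ∀ u, (∃ h ∈ H, φ u = Finsupp.single (h : G ⧸ C) 1) →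
        ∃ h' ∈ H, φ (h * u) = Finsupp.single (h' : G ⧸ C) 1 := by
      intro h hh u hu
      by_cases huH : u ∈ H
      · have := mul_mem hh huH
        exact ⟨_, inv_mem this, by rw [hφF _ this, hF _ this]⟩
      · rwa [hφH' h hh u huH]
    have e2 : ∀ k ∈ K, ∀ u, (∃ h ∈ H, φ u = Finsupp.single (h : G ⧸ C) 1) →
        ∃ h' ∈ H, φ (k * u) = Finsupp.single (h' : G ⧸ C) 1 := by
      intro k hk u hu
      rwa [hφK k hk]
    exact Subgroup.induction_of_closure_union hgen
      ⟨1, one_mem _, by rw [hφ1, hF _ (one_mem _), inv_one]⟩ e1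
      (fun h hh => e1 _ (inv_mem hh)) e2 (fun k hk => e2 _ (inv_mem hk))
  choose f hfH hf using hex
  have hinj : ∀ a b : G, φ a = φ b → (f a : G ⧸ C) = f b := by
    intro a b hab
    rw [hf, hf] at hab
    exact Finsupp.single_left_injective one_ne_zero hab
  -- Inversion turns the last factor into the first and left multiplications into right ones.
  refine ⟨fun g => f g⁻¹, fun g => ⟨_, hfH _, rfl⟩, fun h hh => ?_, fun g k hk => ?_,
    fun g hg h hh => ?_⟩
  · have := hφF _ (inv_mem hh)
    rw [hf, hF _ (inv_mem hh), inv_inv] at this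
    exact Finsupp.single_left_injective one_ne_zero this
  · apply hinj
    rw [mul_inv_rev, hφK _ (inv_mem hk)]
  · apply hinj
    rw [mul_inv_rev, hφH' _ (inv_mem hh)]
    simpa using hg

/-- As `C ≤ K`, the first coset is constant on left cosets of `C`. It changes along an edge only for
a step by `H` starting in `H`, and such an edge lies in the block. -/
theorem exists_isBlockRetraction_of_amalgam (hCH : C ≤ H) (hCK : C ≤ K)
    (hgen : Subgroup.closure ((H : Set G) ∪ K) = ⊤)
    (hlift : ∀ Φ₁ Φ₂ : G →* Equiv.Perm (G × (G ⧸ C →₀ ℤ)), (∀ c ∈ C, Φ₁ c = Φ₂ c) →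
      ∃ Φ : G →* Equiv.Perm (G × (G ⧸ C →₀ ℤ)), (∀ h ∈ H, Φ h = Φ₁ h) ∧ ∀ k ∈ K, Φ k = Φ₂ k)
    {S : Set G} (hS : ∀ s ∈ S, s ∈ H ∨ s ∈ K) :
    ∃ ρ, IsBlockRetraction (cosetGraph C S) ((fun g : G => (g : G ⧸ C)) '' H) ρ := by
  obtain ⟨ρ, h1, h2, h3, h4⟩ := exists_first_coset_of_amalgam hCH hgen hlift
  have hout : ∀ g : G, ρ (g : G ⧸ C).out = ρ g := by
    intro g
    obtain ⟨c, hc⟩ := QuotientGroup.mk_out_eq_mul C g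
    rw [hc, h3 _ _ (hCK c.2)]
  refine ⟨fun v => ρ v.out, IsBlockRetraction.cosetGraph (fun v => ?_) ?_ fun g s hs => ?_⟩
  · obtain ⟨h, hh, he⟩ := h1 v.out
    exact ⟨h, hh, he.symm⟩
  · rintro _ ⟨h, hh, rfl⟩
    exact (hout h).trans (h2 h hh)
  · rw [hout, hout]
    rcases hS s hs with hs | hs
    · by_cases hg : g ∈ H
      · exact Or.inl ⟨⟨g, hg, rfl⟩, ⟨_, mul_mem hg hs, rfl⟩⟩
      · exact Or.inr (h4 g hg s hs).symm
    · exact Or.inr (h3 g s hs).symm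

end Amalgam

/-! ### Reduced decompositions in HNN extensions -/

section HNN

variable {G : Type*} [Group G] {H C D : Subgroup G} {t : G}

/-- In an HNN extension of `H` with stable letter `t` the first edge of the Bass–Serre tree in a
reduced decomposition of an element outside of `H` is well defined. -/
theorem exists_first_coset_of_hnn (hCH : C ≤ H) (hDH : D ≤ H)
    (ht : ∀ d ∈ D, t * d * t⁻¹ ∈ C) (hgen : Subgroup.closure ((H : Set G) ∪ {t}) = ⊤)
    (hlift : ∀ (Φ : G →* Equiv.Perm (G × (G ⧸ C →₀ ℤ))) (τ : Equiv.Perm (G × (G ⧸ C →₀ ℤ))),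
      (∀ d ∈ D, τ * Φ d = Φ (t * d * t⁻¹) * τ) →
      ∃ Ψ : G →* Equiv.Perm (G × (G ⧸ C →₀ ℤ)), (∀ h ∈ H, Ψ h = Φ h) ∧ Ψ t = τ) :
    ∃ ψ : G → G ⧸ C, (∀ g, ∃ h ∈ H, ψ g = h ∨ ψ g = ((h * t⁻¹ : G) : G ⧸ C)) ∧
      (∀ g ∉ H, ∀ h ∈ H, ψ (g * h) = ψ g) ∧ (∀ g ∉ H, g * t⁻¹ ∉ H → ψ (g * t⁻¹) = ψ g) ∧
      (∀ g ∈ H, g * t⁻¹ ∉ H → ψ (g * t⁻¹) = ((g * t⁻¹ : G) : G ⧸ C)) ∧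
      ∀ g ∉ H, g * t⁻¹ ∈ H → ψ g = ((g * t⁻¹ : G) : G ⧸ C) := by
  classical
  let e : G → ℤ := fun g => if g ∈ H then 1 else 0
  have he1 : ∀ g ∈ H, e g = 1 := fun g hg => if_pos hg
  have he0 : ∀ g ∉ H, e g = 0 := fun g hg => if_neg hg
  have heH : ∀ h ∈ H, ∀ g, e (h * g) = e g := by
    intro h hh g
    simp only [e, H.mul_mem_cancel_left hh]
  -- The tree edge `g⁻¹t⁻¹C` joins the vertices `g⁻¹t⁻¹H` and `g⁻¹H`. It is recorded when exactly
  -- one of them is the base vertex `H`; with this sign, both directions of crossing give `φ` the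
  -- coefficient `+1`.
  let c : G → (G ⧸ C →₀ ℤ) := fun g =>
    Finsupp.single ((g⁻¹ * t⁻¹ : G) : G ⧸ C) (e g - e (t * g))
  have hc : ∀ d ∈ D, ∀ g, c (d * g) = c g := by
    intro d hd g
    have h1 : t * (d * g) = t * d * t⁻¹ * (t * g) := by group
    have h2 : (((d * g)⁻¹ * t⁻¹ : G) : G ⧸ C) = ((g⁻¹ * t⁻¹ : G) : G ⧸ C) := by
      rw [QuotientGroup.eq]
      have := ht d hd
      simpa [mul_assoc] using this
    simp only [c]
    rw [h2, heH d (hDH hd), h1, heH _ (hCH (ht d hd))]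
  -- Only the stable letter is twisted. Compatibility with the relations is the invariance `hc` of
  -- `c` under left multiplication by `D`.
  obtain ⟨Φ, hΦH, hΦt⟩ := hlift (translationPerm G _) (translationPerm G _ t * shearPerm c) (by
    intro d hd
    ext p : 1
    simp [hc d hd, mul_assoc])
  have hH : ∀ h ∈ H, ∀ p, Φ h p = (h * p.1, p.2) := by
    intro h hh p
    simp [hΦH h hh]
  have hT : ∀ p, Φ t p = (t * p.1, p.2 + c p.1) := by
    intro p
    simp [hΦt]
  have hT' : ∀ p, Φ t⁻¹ p = (t⁻¹ * p.1, p.2 - c (t⁻¹ * p.1)) := by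
    intro p
    rw [map_inv, Equiv.Perm.inv_eq_iff_eq, hT]
    simp
  have hfst : ∀ u p, (Φ u p).1 = u * p.1 := by
    have e1 : ∀ h ∈ H, ∀ u, (∀ p, (Φ u p).1 = u * p.1) → ∀ p, (Φ (h * u) p).1 = h * u * p.1 := by
      intro h hh u hu p
      rw [map_mul, Equiv.Perm.mul_apply, hH h hh, hu, mul_assoc]
    refine Subgroup.induction_of_closure_union hgen (by simp) e1 (fun h hh => e1 _ (inv_mem hh))
      ?_ ?_
    · rintro _ rfl u hu p
      rw [map_mul, Equiv.Perm.mul_apply, hT, hu, mul_assoc]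
    · rintro _ rfl u hu p
      rw [map_mul, Equiv.Perm.mul_apply, hT', hu, mul_assoc]
  -- `φ` vanishes on `H`. For `u` outside of `H` it is the first edge on the tree path from the
  -- vertex `H` to `u⁻¹H`.
  let φ : G → (G ⧸ C →₀ ℤ) := fun u => (Φ u (1, 0)).2
  have hφH : ∀ h ∈ H, ∀ u, φ (h * u) = φ u := by
    intro h hh u
    change (Φ (h * u) (1, 0)).2 = _
    rw [map_mul, Equiv.Perm.mul_apply, hH h hh]
  have hφt : ∀ u, φ (t * u) = φ u + c u := by
    intro u
    change (Φ (t * u) (1, 0)).2 = _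
    rw [map_mul, Equiv.Perm.mul_apply, hT, hfst, mul_one]
  have hφ0 : ∀ h ∈ H, φ h = 0 := by
    intro h hh
    have := hφH h hh 1
    rw [mul_one] at this
    rw [this]
    simp [φ]
  have hφ2 : ∀ u ∉ H, t * u ∉ H → φ (t * u) = φ u := by
    intro u hu htu
    simp [hφt, c, he0 _ hu, he0 _ htu]
  have hφ3 : ∀ u ∈ H, t * u ∉ H → φ (t * u) = Finsupp.single ((u⁻¹ * t⁻¹ : G) : G ⧸ C) 1 := by
    intro u hu htu
    simp [hφt, c, he1 _ hu, he0 _ htu, hφ0 u hu]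
  have hφ4 : ∀ u ∉ H, t * u ∈ H → φ u = Finsupp.single ((u⁻¹ * t⁻¹ : G) : G ⧸ C) 1 := by
    intro u hu htu
    have := hφt u
    rw [hφ0 _ htu, eq_comm, add_eq_zero_iff_eq_neg] at this
    simp [this, c, he0 _ hu, he1 _ htu, ← Finsupp.single_neg]
  let p : G → Prop := fun u => u ∉ H → ∃ h ∈ H, φ u = Finsupp.single (h : G ⧸ C) 1 ∨
    φ u = Finsupp.single ((h * t⁻¹ : G) : G ⧸ C) 1
  have hp : ∀ u, p u := by
    have e1 : ∀ h ∈ H, ∀ u, p u → p (h * u) := by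
      intro h hh u hu hhu
      rw [hφH h hh]
      exact hu fun h' => hhu (mul_mem hh h')
    refine Subgroup.induction_of_closure_union hgen (fun h => absurd (one_mem H) h) e1
      (fun h hh => e1 _ (inv_mem hh)) ?_ ?_
    · rintro _ rfl u hu htu
      by_cases huH : u ∈ H
      · exact ⟨u⁻¹, inv_mem huH, Or.inr (hφ3 u huH htu)⟩
      · rw [hφ2 u huH htu]
        exact hu huH
    · rintro s hs u hu htu
      obtain rfl : s = t := hs
      by_cases huH : u ∈ H
      · refine ⟨u⁻¹, inv_mem huH, Or.inl ?_⟩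
        simpa using hφ4 (s⁻¹ * u) htu (by simpa using huH)
      · have := hφ2 (s⁻¹ * u) htu (by simpa using huH)
        rw [← this, mul_inv_cancel_left]
        exact hu huH
  have hex : ∀ u, ∃ v : G ⧸ C, (∃ h ∈ H, v = h ∨ v = ((h * t⁻¹ : G) : G ⧸ C)) ∧
      (u ∉ H → φ u = Finsupp.single v 1) := by
    intro u
    by_cases hu : u ∈ H
    · exact ⟨_, ⟨1, one_mem H, Or.inl rfl⟩, fun h => absurd hu h⟩
    · obtain ⟨h, hh, he | he⟩ := hp u hu
      · exact ⟨_, ⟨h, hh, Or.inl rfl⟩, fun _ => he⟩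
      · exact ⟨_, ⟨h, hh, Or.inr rfl⟩, fun _ => he⟩
  choose f hfP hf using hex
  have hinj : ∀ a, ∀ v : G ⧸ C, a ∉ H → φ a = Finsupp.single v 1 → f a = v := by
    intro a v ha hab
    rw [hf a ha] at hab
    exact Finsupp.single_left_injective one_ne_zero hab
  have hinv : ∀ {g}, g ∉ H → g⁻¹ ∉ H := fun hg h => hg (by simpa using inv_mem h)
  refine ⟨fun g => f g⁻¹, fun g => hfP _, fun g hg h hh => ?_, fun g hg htg => ?_,
    fun g hg htg => ?_, fun g hg htg => ?_⟩
  · refine hinj _ _ (hinv fun h' => hg ((H.mul_mem_cancel_right hh).1 h')) ?_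
    rw [mul_inv_rev, hφH _ (inv_mem hh), hf _ (hinv hg)]
  · refine hinj _ _ (hinv htg) ?_
    have h1 := hinv htg
    rw [mul_inv_rev, inv_inv] at h1 ⊢
    rw [hφ2 _ (hinv hg) h1, hf _ (hinv hg)]
  · refine hinj _ _ (hinv htg) ?_
    have h1 := hinv htg
    rw [mul_inv_rev, inv_inv] at h1 ⊢
    rw [hφ3 _ (inv_mem hg) h1, inv_inv]
  · refine hinj _ _ (hinv hg) ?_
    have h1 := inv_mem htg
    rw [mul_inv_rev, inv_inv] at h1
    rw [hφ4 _ (hinv hg) h1, inv_inv]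

/-- The block is the star of the tree vertex `H`: its edges are `hC` and `ht⁻¹C`. A generator in `H`
joins two edges at `gH`, and `t` joins two edges at `gtH`. Either that vertex is `H`, or both have
the same first edge. -/
theorem exists_isBlockRetraction_of_hnn (hCH : C ≤ H) (hDH : D ≤ H)
    (ht : ∀ d ∈ D, t * d * t⁻¹ ∈ C) (hgen : Subgroup.closure ((H : Set G) ∪ {t}) = ⊤)
    (hlift : ∀ (Φ : G →* Equiv.Perm (G × (G ⧸ C →₀ ℤ))) (τ : Equiv.Perm (G × (G ⧸ C →₀ ℤ))),
      (∀ d ∈ D, τ * Φ d = Φ (t * d * t⁻¹) * τ) →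
      ∃ Ψ : G →* Equiv.Perm (G × (G ⧸ C →₀ ℤ)), (∀ h ∈ H, Ψ h = Φ h) ∧ Ψ t = τ)
    {S : Set G} (hS : ∀ s ∈ S, s ∈ H ∨ s = t) :
    ∃ ρ, IsBlockRetraction (cosetGraph C S)
      {v | ∃ h ∈ H, v = (h : G ⧸ C) ∨ v = ((h * t⁻¹ : G) : G ⧸ C)} ρ := by
  classical
  obtain ⟨ψ, h0, h1, h2, h3, h4⟩ := exists_first_coset_of_hnn hCH hDH ht hgen hlift
  set P : Set (G ⧸ C) := {v | ∃ h ∈ H, v = (h : G ⧸ C) ∨ v = ((h * t⁻¹ : G) : G ⧸ C)} with hP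
  let ρ : G ⧸ C → G ⧸ C := fun v => if v ∈ P then v else ψ v.out
  have hρ : ∀ v ∈ P, ρ v = v := fun v hv => if_pos hv
  have hρ' : ∀ v ∉ P, ρ v = ψ v.out := fun v hv => if_neg hv
  have hmk : ∀ g ∉ H, ρ (g : G ⧸ C) = ψ g := by
    intro g hg
    -- A coset `gC` in the block with `g ∉ H` must be some `ht⁻¹C`, and such an edge is its own
    -- first edge.
    by_cases hgP : (g : G ⧸ C) ∈ P
    · rw [hρ _ hgP]
      obtain ⟨h, hh, he | he⟩ := hgP
      · have := QuotientGroup.eq.1 he.symm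
        exact absurd ((H.mul_mem_cancel_left (inv_mem hh)).1 (hCH this)) hg
      · have hmem := QuotientGroup.eq.1 he
        have hht : h * t⁻¹ = g * (g⁻¹ * (h * t⁻¹)) := by group
        have hn : h * t⁻¹ ∉ H := by
          rw [hht]
          exact fun h' => hg ((H.mul_mem_cancel_right (hCH hmem)).1 h')
        rw [he, ← h3 h hh hn, ← h1 g hg _ (hCH hmem), ← hht]
    · rw [hρ' _ hgP]
      obtain ⟨c, hc⟩ := QuotientGroup.mk_out_eq_mul C g
      rw [hc, h1 g hg _ (hCH c.2)]
  have hmkt : ∀ g ∉ H, ρ ((g * t⁻¹ : G) : G ⧸ C) = ψ g := by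
    intro g hg
    by_cases hgt : g * t⁻¹ ∈ H
    · rw [hρ _ ⟨_, hgt, Or.inl rfl⟩, h4 g hg hgt]
    · rw [hmk _ hgt, h2 g hg hgt]
  refine ⟨ρ, IsBlockRetraction.cosetGraph (fun v => ?_) hρ fun g s hs => ?_⟩
  · by_cases hv : v ∈ P
    · rwa [hρ v hv]
    · rw [hρ' v hv]
      exact h0 _
  · rcases hS s hs with hs | rfl
    · by_cases hg : g ∈ H
      · exact Or.inl ⟨⟨g, hg, Or.inl rfl⟩, ⟨_, mul_mem hg hs, Or.inl rfl⟩⟩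
      · right
        rw [hmk g hg, hmk _ fun h => hg ((H.mul_mem_cancel_right hs).1 h), h1 g hg s hs]
    · have he : g = g * s * s⁻¹ := by group
      by_cases hg : g * s ∈ H
      · refine Or.inl ⟨⟨_, hg, Or.inr ?_⟩, ⟨_, hg, Or.inl rfl⟩⟩
        rw [← he]
      · right
        rw [hmk _ hg]
        nth_rw 1 [he]
        exact hmkt _ hg

end HNN

/-! ### Amalgamated products and HNN extensions of TDLC groups -/

theorem Subgroup.range_le_closure {A G : Type*} [Group A] [Group G] (i : A →* G) {K : Set A}
    (hK : Subgroup.closure K = ⊤) {S : Set G} (hS : i '' K ⊆ S) :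
    i.range ≤ Subgroup.closure S := by
  rw [MonoidHom.range_eq_map, ← hK, MonoidHom.map_closure]
  exact Subgroup.closure_mono hS

namespace AmalgamatedProduct

variable {A : Type u} {B : Type v} {C : Type w} [Group A] [Group B] [Group C]

theorem range_inl_sup_range_inr (iA : C →* A) (iB : C →* B) :
    (inl iA iB).range ⊔ (inr iA iB).range = ⊤ := by
  refine eq_top_iff.2 fun g _ => ?_
  induction g using induction_on with
  | hl a => exact Subgroup.mem_sup_left ⟨a, rfl⟩
  | hr b => exact Subgroup.mem_sup_right ⟨b, rfl⟩
  | hm x y hx hy => exact mul_mem (hx trivial) (hy trivial)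

/-- The universal property, for pairs of homomorphisms that are defined on all of `A *_C B`. -/
theorem exists_lift {iA : C →* A} {iB : C →* B} {M : Type*} [Group M]
    (Φ₁ Φ₂ : AmalgamatedProduct iA iB →* M)
    (h : ∀ c ∈ ((inl iA iB).comp iA).range, Φ₁ c = Φ₂ c) :
    ∃ Φ : AmalgamatedProduct iA iB →* M, (∀ x ∈ (inl iA iB).range, Φ x = Φ₁ x) ∧
      ∀ x ∈ (inr iA iB).range, Φ x = Φ₂ x := by
  refine ⟨lift iA iB (Φ₁.comp (inl iA iB)) (Φ₂.comp (inr iA iB)) fun c => ?_, ?_, ?_⟩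
  · rw [MonoidHom.comp_apply, MonoidHom.comp_apply, ← inl_eq_inr]
    exact h _ ⟨c, rfl⟩
  · rintro _ ⟨a, rfl⟩
    exact lift_inl _ _ _ _ _ a
  · rintro _ ⟨b, rfl⟩
    exact lift_inr _ _ _ _ _ b

theorem isHyperbolicTDLCGroup_iff [TopologicalSpace A] [TopologicalSpace B] [TopologicalSpace C]
    [IsTopologicalGroup C] [CompactSpace C] {iA : C →* A} {iB : C →* B}
    (hA : IsTDLCGroup A) (hAc : IsCompactlyGeneratedGroup A)
    (hB : IsTDLCGroup B) (hBc : IsCompactlyGeneratedGroup B)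
    (hiA : IsOpenEmbedding iA) (hiB : IsOpenEmbedding iB) :
    IsHyperbolicTDLCGroup (AmalgamatedProduct iA iB) ↔
      IsHyperbolicTDLCGroup A ∧ IsHyperbolicTDLCGroup B := by
  have := hA.isTopologicalGroup
  have := hB.isTopologicalGroup
  have := isTopologicalGroup hiA hiB
  have hl := isOpenEmbedding_inl hiA hiB
  have hr := isOpenEmbedding_inr hiA hiB
  obtain ⟨KA, hKA, hKA'⟩ := id hAc
  obtain ⟨KB, hKB, hKB'⟩ := id hBc
  set G := AmalgamatedProduct iA iB
  set C' : Subgroup G := ((inl iA iB).comp iA).range with hC'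
  set S : Set G := inl iA iB '' KA ∪ inr iA iB '' KB with hS
  have hCH : C' ≤ (inl iA iB).range := by
    rintro _ ⟨c, rfl⟩
    exact ⟨iA c, rfl⟩
  have hCK : C' ≤ (inr iA iB).range := by
    rintro _ ⟨c, rfl⟩
    exact ⟨iB c, (inl_eq_inr iA iB c).symm⟩
  have hCo : IsOpen (C' : Set G) := by
    rw [hC', MonoidHom.coe_range]
    exact (hl.comp hiA).isOpen_range
  have hCc : IsCompact (C' : Set G) := by
    rw [hC', MonoidHom.coe_range]
    exact isCompact_range (hl.comp hiA).continuous
  have hSc : IsCompact S := (hKA.image hl.continuous).union (hKB.image hr.continuous)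
  have hgen : Subgroup.closure ((C' : Set G) ∪ S) = ⊤ := by
    rw [← top_le_iff, ← range_inl_sup_range_inr iA iB]
    refine sup_le (Subgroup.range_le_closure _ hKA' ?_) (Subgroup.range_le_closure _ hKB' ?_)
    · exact Set.subset_union_left.trans Set.subset_union_right
    · exact Set.subset_union_right.trans Set.subset_union_right
  have hSmem : ∀ s ∈ S, s ∈ (inl iA iB).range ∨ s ∈ (inr iA iB).range := by
    rintro _ (⟨a, -, rfl⟩ | ⟨b, -, rfl⟩)
    · exact Or.inl ⟨a, rfl⟩
    · exact Or.inr ⟨b, rfl⟩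
  have hsup := range_inl_sup_range_inr iA iB
  rw [Subgroup.sup_eq_closure] at hsup
  obtain ⟨ρA, hρA⟩ := exists_isBlockRetraction_of_amalgam hCH hCK hsup
    (fun Φ₁ Φ₂ h => exists_lift Φ₁ Φ₂ h) hSmem
  obtain ⟨ρB, hρB⟩ := exists_isBlockRetraction_of_amalgam hCK hCH (by rwa [Set.union_comm])
    (fun Φ₁ Φ₂ h => by
      obtain ⟨Φ, h1, h2⟩ := exists_lift Φ₂ Φ₁ fun c hc => (h c hc).symm
      exact ⟨Φ, h2, h1⟩) fun s hs => (hSmem s hs).symm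
  have hZ := isCayleyAbelsGraph_cosetGraph hCo hCc hSc hgen
  have hiffA := isHyperbolicTDLCGroup_iff_block hA hAc (C := iA.range)
    (by rw [MonoidHom.coe_range]; exact hiA.isOpen_range)
    (by rw [MonoidHom.coe_range]; exact isCompact_range hiA.continuous)
    (inl iA iB) hl hZ hρA ((1 : G) : G ⧸ C')
    (fun a => ⟨inl iA iB a, ⟨a, rfl⟩, by simp⟩) 0 (by
      rintro _ ⟨_, ⟨a, rfl⟩, rfl⟩
      exact ⟨a, by simp⟩)
  have hiffB := isHyperbolicTDLCGroup_iff_block hB hBc (C := iB.range)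
    (by rw [MonoidHom.coe_range]; exact hiB.isOpen_range)
    (by rw [MonoidHom.coe_range]; exact isCompact_range hiB.continuous)
    (inr iA iB) hr hZ hρB ((1 : G) : G ⧸ C')
    (fun b => ⟨inr iA iB b, ⟨b, rfl⟩, by simp⟩) 0 (by
      rintro _ ⟨_, ⟨b, rfl⟩, rfl⟩
      exact ⟨b, by simp⟩)
  rw [isHyperbolicTDLCGroup_iff_cosetGraph (hA.of_isOpenEmbedding _ hl) hCo hCc hSc hgen, hiffA,
    hiffB]
  refine ⟨fun h => ⟨hρA.isGromovHyperbolicGraph_induce h, hρB.isGromovHyperbolicGraph_induce h⟩,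
    fun h => ?_⟩
  -- Translation by `g⁻¹` moves the edge to one from the base coset, which lies in both blocks, to
  -- the coset of `s`.
  have hedge : ∀ g : G, ∀ s ∈ S, ∃ (i : Bool) (k : G),
      k • (g : G ⧸ C') ∈ (fun g : G => (g : G ⧸ C')) ''
        (bif i then (inl iA iB).range else (inr iA iB).range : Subgroup G) ∧
      k • ((g * s : G) : G ⧸ C') ∈ (fun g : G => (g : G ⧸ C')) ''
        (bif i then (inl iA iB).range else (inr iA iB).range : Subgroup G) := by
    intro g s hs
    have h1 : g⁻¹ • (g : G ⧸ C') = ((1 : G) : G ⧸ C') := by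
      rw [MulAction.Quotient.smul_coe, smul_eq_mul, inv_mul_cancel]
    have h2 : g⁻¹ • ((g * s : G) : G ⧸ C') = (s : G ⧸ C') := by
      rw [MulAction.Quotient.smul_coe, smul_eq_mul, inv_mul_cancel_left]
    rcases hSmem s hs with hs | hs
    · exact ⟨true, g⁻¹, ⟨1, one_mem _, h1.symm⟩, ⟨s, hs, h2.symm⟩⟩
    · exact ⟨false, g⁻¹, ⟨1, one_mem _, h1.symm⟩, ⟨s, hs, h2.symm⟩⟩
  refine isGromovHyperbolicGraph_of_blocks hZ.connected hZ.smul_adj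
    (fun i : Bool => (fun g : G => (g : G ⧸ C')) ''
      (bif i then (inl iA iB).range else (inr iA iB).range : Subgroup G))
    (fun i => bif i then ρA else ρB) (Bool.forall_bool.2 ⟨hρB, hρA⟩)
    (Bool.forall_bool.2 ⟨h.2, h.1⟩) fun x y hxy => ?_
  obtain ⟨-, ⟨g, s, hs, rfl, rfl⟩ | ⟨g, s, hs, rfl, rfl⟩⟩ :=
    SimpleGraph.fromRel_adj _ _ _ |>.1 hxy
  · exact hedge g s hs
  · obtain ⟨i, k, h1, h2⟩ := hedge g s hs
    exact ⟨i, k, h2, h1⟩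

end AmalgamatedProduct

namespace TopHNNExtension

variable {A : Type u} [Group A] {C D : Subgroup A}

theorem closure_range_of_union_t (α : C ≃* D) :
    Subgroup.closure (((of α).range : Set (TopHNNExtension α)) ∪ {t α}) = ⊤ := by
  refine eq_top_iff.2 fun g _ => ?_
  induction g using induction_on with
  | hof a => exact Subgroup.subset_closure (Or.inl ⟨a, rfl⟩)
  | ht => exact Subgroup.subset_closure (Or.inr rfl)
  | hmul x y hx hy => exact mul_mem (hx trivial) (hy trivial)
  | hinv x hx => exact inv_mem (hx trivial)

/-- The universal property, for homomorphisms from `A` that are defined on all of `A *_C`. -/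
theorem exists_lift {α : C ≃* D} {M : Type*} [Group M] (Φ : TopHNNExtension α →* M) (τ : M)
    (h : ∀ d ∈ D.map (of α), τ * Φ d = Φ (t α * d * (t α)⁻¹) * τ) :
    ∃ Ψ : TopHNNExtension α →* M, (∀ x ∈ (of α).range, Ψ x = Φ x) ∧ Ψ (t α) = τ := by
  refine ⟨HNNExtension.lift (φ := α.symm) (Φ.comp (of α)) τ fun d => ?_, ?_, ?_⟩
  · have := h _ ⟨d, d.2, rfl⟩
    rwa [t_mul_of_mul_t_inv] at this
  · rintro _ ⟨a, rfl⟩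
    exact HNNExtension.lift_of _ _ _ a
  · exact HNNExtension.lift_t _ _ _

theorem isHyperbolicTDLCGroup_iff [TopologicalSpace A] (α : C ≃ₜ* D)
    (hA : IsTDLCGroup A) (hAc : IsCompactlyGeneratedGroup A) (hCo : IsOpen (C : Set A))
    (hCc : IsCompact (C : Set A)) (hDo : IsOpen (D : Set A)) :
    IsHyperbolicTDLCGroup (TopHNNExtension α.toMulEquiv) ↔ IsHyperbolicTDLCGroup A := by
  have := hA.isTopologicalGroup
  have := isTopologicalGroup α hCo hDo
  have hi := isOpenEmbedding_of α.toMulEquiv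
  obtain ⟨K, hK, hK'⟩ := id hAc
  set G := TopHNNExtension α.toMulEquiv
  set i : A →* G := of α.toMulEquiv
  set s : G := t α.toMulEquiv
  set C' : Subgroup G := C.map i with hC'
  set S : Set G := i '' K ∪ {s} with hS
  have hCH : C' ≤ i.range := by
    rintro _ ⟨c, -, rfl⟩
    exact ⟨c, rfl⟩
  have hDH : D.map i ≤ i.range := by
    rintro _ ⟨c, -, rfl⟩
    exact ⟨c, rfl⟩
  have hconj : ∀ d ∈ D.map i, s * d * s⁻¹ ∈ C' := by
    rintro _ ⟨d, hd, rfl⟩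
    rw [t_mul_of_mul_t_inv α.toMulEquiv ⟨d, hd⟩]
    exact ⟨_, SetLike.coe_mem _, rfl⟩
  have hCo' : IsOpen (C' : Set G) := hi.isOpenMap _ hCo
  have hCc' : IsCompact (C' : Set G) := hCc.image hi.continuous
  have hSc : IsCompact S := (hK.image hi.continuous).union isCompact_singleton
  have hgen : Subgroup.closure ((C' : Set G) ∪ S) = ⊤ := by
    rw [← top_le_iff, ← closure_range_of_union_t α.toMulEquiv, Subgroup.closure_le]
    refine Set.union_subset (Subgroup.range_le_closure _ hK' ?_) ?_
    · exact Set.subset_union_left.trans Set.subset_union_right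
    · exact fun x hx => Subgroup.subset_closure (Or.inr (Or.inr hx))
  have hSmem : ∀ x ∈ S, x ∈ i.range ∨ x = s := by
    rintro _ (⟨a, -, rfl⟩ | hx)
    · exact Or.inl ⟨a, rfl⟩
    · exact Or.inr hx
  obtain ⟨ρ, hρ⟩ := exists_isBlockRetraction_of_hnn hCH hDH hconj
    (closure_range_of_union_t α.toMulEquiv) (fun Φ τ h => exists_lift Φ τ h) hSmem
  have hZ := isCayleyAbelsGraph_cosetGraph hCo' hCc' hSc hgen
  have hdist : ∀ g : G, (cosetGraph C' S).dist ((g * s⁻¹ : G) : G ⧸ C') (g : G ⧸ C') ≤ 1 := by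
    intro g
    by_cases he : ((g * s⁻¹ : G) : G ⧸ C') = (g : G ⧸ C')
    · simp [he]
    · refine (SimpleGraph.dist_eq_one_iff_adj.2 ?_).le
      exact SimpleGraph.fromRel_adj _ _ _ |>.2
        ⟨he, Or.inl ⟨g * s⁻¹, s, Or.inr rfl, rfl, by rw [inv_mul_cancel_right]⟩⟩
  -- The orbit of the base coset consists only of the `aC`; the other vertices `at⁻¹C` of the block
  -- are within distance `1` of it, by `hdist`.
  have hiff := isHyperbolicTDLCGroup_iff_block hA hAc hCo hCc i hi hZ hρ ((1 : G) : G ⧸ C')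
    (fun a => ⟨i a, ⟨a, rfl⟩, Or.inl (by simp)⟩) 1 (by
      rintro _ ⟨_, ⟨a, rfl⟩, rfl | rfl⟩
      · exact ⟨a, by simp⟩
      · exact ⟨a, by simpa using hdist (i a)⟩)
  rw [isHyperbolicTDLCGroup_iff_cosetGraph (hA.of_isOpenEmbedding _ hi) hCo' hCc' hSc hgen, hiff]
  refine ⟨fun h => hρ.isGromovHyperbolicGraph_induce h, fun h => ?_⟩
  have hedge : ∀ g : G, ∀ x ∈ S, ∃ (_ : Unit) (k : G),
      k • (g : G ⧸ C') ∈ {v : G ⧸ C' | ∃ h ∈ i.range, v = h ∨ v = ((h * s⁻¹ : G) : G ⧸ C')} ∧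
      k • ((g * x : G) : G ⧸ C') ∈
        {v : G ⧸ C' | ∃ h ∈ i.range, v = h ∨ v = ((h * s⁻¹ : G) : G ⧸ C')} := by
    intro g x hx
    rcases hSmem x hx with hx | rfl
    · refine ⟨(), g⁻¹, ⟨1, one_mem _, Or.inl ?_⟩, ⟨x, hx, Or.inl ?_⟩⟩
      · rw [MulAction.Quotient.smul_coe, smul_eq_mul, inv_mul_cancel]
      · rw [MulAction.Quotient.smul_coe, smul_eq_mul, inv_mul_cancel_left]
    -- The tree edges `gC` and `gsC` meet in the vertex `gsH`, so the translation is by `(g * s)⁻¹`,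
    -- which yields `s⁻¹C` and `C`.
    · refine ⟨(), (g * s)⁻¹, ⟨1, one_mem _, Or.inr ?_⟩, ⟨1, one_mem _, Or.inl ?_⟩⟩
      · have he : (g * s)⁻¹ * g = 1 * s⁻¹ := by group
        rw [MulAction.Quotient.smul_coe, smul_eq_mul, he]
      · rw [MulAction.Quotient.smul_coe, smul_eq_mul, inv_mul_cancel]
  refine isGromovHyperbolicGraph_of_blocks hZ.connected hZ.smul_adj
    (fun _ : Unit => {v : G ⧸ C' | ∃ h ∈ i.range, v = h ∨ v = ((h * s⁻¹ : G) : G ⧸ C')})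
    (fun _ => ρ) (fun _ => hρ) (fun _ => h) fun x y hxy => ?_
  obtain ⟨-, ⟨g, x, hx, rfl, rfl⟩ | ⟨g, x, hx, rfl, rfl⟩⟩ :=
    SimpleGraph.fromRel_adj _ _ _ |>.1 hxy
  · exact hedge g x hx
  · obtain ⟨j, k, h1, h2⟩ := hedge g x hx
    exact ⟨j, k, h2, h1⟩

end TopHNNExtension

theorem corollary3p2 :
    (∀ (A : Type u) (B : Type v) (C : Type w)
      [Group A] [TopologicalSpace A] [Group B] [TopologicalSpace B]
      [Group C] [TopologicalSpace C] [IsTopologicalGroup C] [CompactSpace C]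
      (iA : C →* A) (iB : C →* B),
      IsTDLCGroup A → IsCompactlyGeneratedGroup A →
      IsTDLCGroup B → IsCompactlyGeneratedGroup B →
      IsOpenEmbedding iA → IsOpenEmbedding iB →
      (IsHyperbolicTDLCGroup (AmalgamatedProduct iA iB) ↔
        IsHyperbolicTDLCGroup A ∧ IsHyperbolicTDLCGroup B)) ∧
    (∀ (A : Type u) [Group A] [TopologicalSpace A] (C D : Subgroup A) (α : C ≃ₜ* D),
      IsTDLCGroup A → IsCompactlyGeneratedGroup A →
      IsOpen (C : Set A) → IsCompact (C : Set A) → IsOpen (D : Set A) →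
      (IsHyperbolicTDLCGroup (TopHNNExtension α.toMulEquiv) ↔ IsHyperbolicTDLCGroup A)) := by
  refine ⟨?_, ?_⟩
  · intro A B C _ _ _ _ _ _ _ _ iA iB hA hAc hB hBc hiA hiB
    exact AmalgamatedProduct.isHyperbolicTDLCGroup_iff hA hAc hB hBc hiA hiB
  · intro A _ _ C D α hA hAc hCo hCc hDo
    exact TopHNNExtension.isHyperbolicTDLCGroup_iff α hA hAc hCo hCc hDo
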